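/- **Theorem.** All algorithms are run on the unit-cost word RAM with words of $O(\log(\ell+T))$ bits, where $\ell$ is the number of cells of the input and $T$ is the running time. Algorithms are either deterministic or randomized; a randomized algorithm may flip fair coins, always respects its time bound, and on every input answers correctly with probability at least $2/3$. The *Strong Exponential Time Hypothesis* (SETH) for a class of algorithms (deterministic or randomized) says: for every $\epsilon>0$ there is a $k$ such that no algorithm of this class decides the satisfiability of $k$-CNF formulas with $N$ variables and encoding length $\ell$ in time $\mathrm{poly}(\ell)\cdot 2^{(1-\epsilon)N}$. A *concurrent alphabet* $(\Sigma,\mathcal I)$ is a finite alphabet $\Sigma$ with an irreflexive symmetric relation $\mathcal I\subseteq\Sigma\times\Sigma$. Its *width* is the size of a largest clique of the graph $(\Sigma,\mathcal I)$. Let $\equiv_{\mathcal I}$ be the smallest equivalence relation on $\Sigma^*$ with $w_1abw_2\equiv_{\mathcal I}w_1baw_2$ for all $(a,b)\in\mathcal I$ and $w_1,w_2\in\Sigma^*$. For a fixed concurrent alphabet $(\Sigma,\mathcal I)$ and a fixed language $L\subseteq\Sigma^*$, *predictive trace monitoring* against $L$ is the following problem: given $w\in\Sigma^*$, decide whether there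 is a word $w'\equiv_{\mathcal I}w$ with $w'\in L$. A language is *star-free* if it is obtained from $\emptyset$, $\{\varepsilon\}$ and the languages $\{a\}$, $a\in\Sigma$, by finitely many unions, intersections, concatenations and complementations. Assume SETH for randomized (respectively deterministic) algorithms. Then for every $\epsilon>0$ and every integer $\alpha\ge 1$, predictive trace monitoring against star-free languages over concurrent alphabets of width $\alpha$ cannot be solved in time $O(n^{\alpha-\epsilon})$ on words of length $n$: there are a concurrent alphabet $(\Sigma,\mathcal I)$ of width $\alpha$ and a star-free language $L\subseteq\Sigma^*$ such that no randomized (respectively deterministic) algorithm solves predictive trace monitoring against $L$ in time $O(n^{\alpha-\epsilon})$. -/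

import Mathlib

open Filter MeasureTheory
open scoped ENNReal

/-! ### Concurrent alphabets, trace equivalence, star-free languages

An independence relation on an alphabet `A` is an irreflexive symmetric relation on `A`, that is, a
`SimpleGraph A`. The width of the concurrent alphabet is the clique number of this graph,
`SimpleGraph.cliqueNum`. -/

/-- `v` arises from `u` by exchanging two adjacent independent letters. -/
def TraceSwap {A : Type*} (I : SimpleGraph A) (u v : List A) : Prop :=
  ∃ (w₁ w₂ : List A) (a b : A), I.Adj a b ∧ u = w₁ ++ [a, b] ++ w₂ ∧ v = w₁ ++ [b, a] ++ w₂

/-- Mazurkiewicz trace equivalence: the smallest equivalence relation on words that contains all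
exchanges of adjacent independent letters. -/
def TraceEquiv {A : Type*} (I : SimpleGraph A) : List A → List A → Prop :=
  Relation.EqvGen (TraceSwap I)

/-- The yes-instances of predictive trace monitoring for the concurrent alphabet `(A, I)` and the
language `L`: the words that are trace equivalent to a word of `L`. -/
def PredictiveMonitoring {A : Type*} (I : SimpleGraph A) (L : Language A) : Set (List A) :=
  {w | ∃ w' : List A, TraceEquiv I w w' ∧ w' ∈ L}

/-- Star-free languages over `A`: built from the empty language, the empty word and single letters
by union, intersection, concatenation and complementation. -/
inductive IsStarFree {A : Type*} : Language A → Prop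
  | empty : IsStarFree (⊥ : Language A)
  | epsilon : IsStarFree ({[]} : Language A)
  | letter (a : A) : IsStarFree ({[a]} : Language A)
  | union {L M : Language A} : IsStarFree L → IsStarFree M → IsStarFree (L ⊔ M)
  | inter {L M : Language A} : IsStarFree L → IsStarFree M → IsStarFree (L ⊓ M)
  | concat {L M : Language A} : IsStarFree L → IsStarFree M → IsStarFree (L * M)
  | compl {L : Language A} : IsStarFree L → IsStarFree Lᶜ

/-! ### The word RAM

Unit cost, random access, words of `O(log (input length + running time))` bits, optional coin
flips. The word length is imposed on the runs in `WordRAM.Decides`: no cell may ever hold a number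
above a fixed power of (input length + running time + 2). -/

namespace WordRAM

/-- The arithmetic and bitwise operations on words. -/
inductive Op
  | add | sub | mul | div | mod | land | lor | xor | shl | shr

def Op.eval : Op → ℕ → ℕ → ℕ
  | .add, x, y => x + y
  | .sub, x, y => x - y
  | .mul, x, y => x * y
  | .div, x, y => x / y
  | .mod, x, y => x % y
  | .land, x, y => x &&& y
  | .lor, x, y => x ||| y
  | .xor, x, y => x ^^^ y
  | .shl, x, y => x <<< y
  | .shr, x, y => x >>> y

/-- Instructions. The arguments `dst`, `a`, `b`, `src` are indices of registers. -/
inductive Instr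
  /-- put the literal `c` into register `dst` -/
  | const (dst c : ℕ)
  /-- put the result of `f` on registers `a` and `b` into register `dst` -/
  | arith (f : Op) (dst a b : ℕ)
  /-- put the memory cell whose address is in register `a` into register `dst` -/
  | load (dst a : ℕ)
  /-- put register `src` into the memory cell whose address is in register `a` -/
  | store (a src : ℕ)
  /-- go to instruction number `target` if register `a` is zero -/
  | jumpIfZero (a target : ℕ)
  /-- put a fresh uniformly random bit into register `dst` -/
  | flip (dst : ℕ)

/-- A program is a finite list of instructions, numbered from `0`. -/
abbrev Program := List Instr

structure Config where
  /-- number of the next instruction -/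
  pc : ℕ
  /-- contents of the registers -/
  reg : ℕ → ℕ
  /-- contents of the memory -/
  mem : ℕ → ℕ
  /-- number of coins flipped so far -/
  coins : ℕ

/-- The effect of one instruction, when the outcomes of the coin flips are `ω 0, ω 1, …`. -/
def Instr.exec (ω : ℕ → Bool) (c : Config) : Instr → Config
  | .const dst v => { c with pc := c.pc + 1, reg := Function.update c.reg dst v }
  | .arith f dst a b =>
      { c with pc := c.pc + 1, reg := Function.update c.reg dst (f.eval (c.reg a) (c.reg b)) }
  | .load dst a => { c with pc := c.pc + 1, reg := Function.update c.reg dst (c.mem (c.reg a)) }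
  | .store a src => { c with pc := c.pc + 1, mem := Function.update c.mem (c.reg a) (c.reg src) }
  | .jumpIfZero a target => { c with pc := if c.reg a = 0 then target else c.pc + 1 }
  | .flip dst =>
      { c with
        pc := c.pc + 1
        reg := Function.update c.reg dst (ω c.coins).toNat
        coins := c.coins + 1 }

/-- One step. The machine has halted when there is no instruction with number `pc`. -/
def step (p : Program) (ω : ℕ → Bool) (c : Config) : Config :=
  match p[c.pc]? with
  | none => c
  | some i => i.exec ω c

/-- Initially memory cells `0, 1, …` hold the input, one entry per cell, register `0` holds its
length, and everything else is zero. -/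
def init (x : List ℕ) : Config where
  pc := 0
  reg := fun i => if i = 0 then x.length else 0
  mem := fun i => x.getD i 0
  coins := 0

/-- The configuration after `t` steps on input `x`. -/
def run (p : Program) (ω : ℕ → Bool) (x : List ℕ) (t : ℕ) : Config :=
  (step p ω)^[t] (init x)

def Config.Halted (p : Program) (c : Config) : Prop := p.length ≤ c.pc

/-- The answer of a halted machine is in register `0`: nonzero for yes, zero for no. -/
def Config.Accepting (c : Config) : Prop := c.reg 0 ≠ 0

/-- All cells hold numbers that are at most `B`. -/
def Config.Fits (B : ℕ) (c : Config) : Prop := (∀ i, c.reg i ≤ B) ∧ ∀ i, c.mem i ≤ B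

/-- The law of an infinite sequence of independent fair coins. -/
noncomputable def coinMeasure : Measure (ℕ → Bool) :=
  Measure.infinitePi fun _ => (PMF.uniformOfFintype Bool).toMeasure

/-- The two kinds of algorithms: without and with coin flips. -/
inductive Mode
  | deterministic
  | randomized

/-- Which programs a mode admits: all of them in randomized mode, those without coin flips in
deterministic mode. -/
def Mode.Admits : Mode → Program → Prop
  | .deterministic, p => ∀ i ∈ p, ∀ dst, i ≠ Instr.flip dst
  | .randomized, _ => True

/-- The program `p` decides the decision problem with instances `ι`, presented to the machine
through `enc`, and yes-instances `Y`, in time `T`: on every instance `x`, whatever the coins, it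
halts within `T x` steps with words of `O(log (|enc x| + T x))` bits, and its answer is correct with
probability at least `2/3`. (A program without coin flips then always answers correctly.) -/
def Decides {ι : Type*} (p : Program) (enc : ι → List ℕ) (Y : Set ι) (T : ι → ℕ) : Prop :=
  ∃ c : ℕ, ∀ x : ι,
    (∀ ω : ℕ → Bool,
      (run p ω (enc x) (T x)).Halted p ∧
      ∀ t ≤ T x, (run p ω (enc x) t).Fits (((enc x).length + T x + 2) ^ c)) ∧
    (2 / 3 : ℝ≥0∞) ≤
      coinMeasure {ω | (run p ω (enc x) (T x)).Accepting ↔ x ∈ Y}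

end WordRAM

/-! ### The strong exponential time hypothesis -/

/-- Formulas in conjunctive normal form with at most `k` literals per clause. The literal `(v, b)`
is satisfied by the assignments that give the variable `v` the value `b`. -/
structure KCNF (k : ℕ) where
  numVars : ℕ
  clauses : List (List (Fin numVars × Bool))
  length_le : ∀ C ∈ clauses, C.length ≤ k

namespace KCNF

def Satisfiable {k : ℕ} (φ : KCNF k) : Prop :=
  ∃ a : Fin φ.numVars → Bool, ∀ C ∈ φ.clauses, ∃ l ∈ C, a l.1 = l.2

/-- The number of variables, then the clauses one after the other, each terminated by `0`; the
literal `(v, b)` has the code `2 * v + b + 1`. -/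
def encode {k : ℕ} (φ : KCNF k) : List ℕ :=
  φ.numVars :: φ.clauses.flatMap fun C =>
    C.map (fun l => 2 * (l.1 : ℕ) + l.2.toNat + 1) ++ [0]

end KCNF

/-- The strong exponential time hypothesis for the algorithms of the given mode: for every `ε > 0`
there is a `k` such that no algorithm decides the satisfiability of `k`-CNF formulas with `N`
variables and encoding length `ℓ` in time `poly(ℓ) * 2 ^ ((1 - ε) * N)`. -/
def SETH (m : WordRAM.Mode) : Prop :=
  ∀ ε : ℝ, 0 < ε → ∃ k : ℕ,
    ¬ ∃ (p : WordRAM.Program) (T : KCNF k → ℕ) (c : ℕ),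
      m.Admits p ∧
      WordRAM.Decides p KCNF.encode {φ | φ.Satisfiable} T ∧
      ∀ φ : KCNF k,
        (T φ : ℝ) ≤ c * (φ.encode.length : ℝ) ^ c * (2 : ℝ) ^ ((1 - ε) * (φ.numVars : ℝ))

/-! ### Monitoring in a given time -/

/-- Predictive trace monitoring for the fixed concurrent alphabet `(Fin s, I)` and the fixed
language `L` is solved by an algorithm of mode `m` in time `O(n ^ e)` on words of length `n`. The
input word is stored one letter per memory cell. -/
def MonitoringSolvable (m : WordRAM.Mode) {s : ℕ} (I : SimpleGraph (Fin s))
    (L : Language (Fin s)) (e : ℝ) : Prop :=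
  ∃ (p : WordRAM.Program) (T : ℕ → ℕ),
    m.Admits p ∧
    WordRAM.Decides p (fun w : List (Fin s) => w.map (fun a => (a : ℕ)))
      (PredictiveMonitoring I L) (fun w => T w.length) ∧
    (fun n : ℕ => (T n : ℝ)) =O[atTop] (fun n : ℕ => (n : ℝ) ^ e)

/-!
# Lower bounds for predictive trace monitoring from the strong exponential time hypothesis

For `α ≥ 2`, satisfiability is reduced to monitoring. The alphabet `threadGraph α` consists of `α`
threads, and letters are independent when they are in different threads, so that the words
equivalent to `w` are the shuffles of the projections of `w` to the threads
(`traceEquiv_comap_top_iff`). The `N` variables of a formula are distributed to the threads.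
The projection of the word `formulaWord` to a thread is a list of blocks, in which every assignment
to the variables of the thread has a block; a block goes through the encoding of the formula and
shows which literals the assignment makes true. The star-free language `checkLanguage α` asks for
a factor in which the threads take turns, beginning a block all at once, such that between two
consecutive ends of clauses some thread shows a true literal. The shuffles allow every thread to
start this lockstep run at a block of its choice, independently of the others, and lockstep ensures
that the blocks are compared position by position. Hence a shuffle in the language exists if and
only if the formula is satisfiable (`IsBlockWord.exists_of_mem`, `IsBlockWord.mem_predictiveMonitoring`,
`formulaWord_mem_iff`).

The word has length `n = O(ℓ * 2 ^ (N / α))`, and an algorithm for monitoring in time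
`O(n ^ (α - ε))` decides satisfiability in time `poly(ℓ) * 2 ^ ((1 - ε / α) * N)`
(`not_monitoringSolvable_checkLanguage`). On the word RAM, each letter is the value of one
arithmetic expression in its number and in the cells of the input. A single loop writes the word
behind the input, and the given program then runs with all its memory addresses shifted
(`WordRAM.tabulateThen_correct`).

Writing the word takes time `n`, so for `α = 1` the reduction is too slow to be of use. In this case
no hypothesis is needed: a program that searches a word for a letter must read a constant fraction
of its positions on average (`WordRAM.le_three_mul_of_distinguishes`), hence it takes linear time.
-/

/-! ### Runs with bounded words and straight-line code -/

namespace WordRAM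

/-- From `c`, the program reaches `c'` in exactly `t` steps, and no cell ever exceeds `B`. -/
def SafeRun (P : Program) (ω : ℕ → Bool) (B : ℕ) (c : Config) (t : ℕ) (c' : Config) : Prop :=
  (step P ω)^[t] c = c' ∧ ∀ s ≤ t, ((step P ω)^[s] c).Fits B

theorem SafeRun.refl {P : Program} {ω : ℕ → Bool} {B : ℕ} {c : Config} (h : c.Fits B) :
    SafeRun P ω B c 0 c := by
  refine ⟨rfl, fun s hs => ?_⟩
  obtain rfl : s = 0 := by omega
  exact h

theorem SafeRun.trans {P : Program} {ω : ℕ → Bool} {B : ℕ} {c c' c'' : Config} {t t' : ℕ}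
    (h : SafeRun P ω B c t c') (h' : SafeRun P ω B c' t' c'') :
    SafeRun P ω B c (t + t') c'' := by
  obtain ⟨h1, h2⟩ := h
  obtain ⟨h3, h4⟩ := h'
  refine ⟨by rw [Nat.add_comm, Function.iterate_add_apply, h1, h3], fun s hs => ?_⟩
  rcases le_total s t with hst | hst
  · exact h2 s hst
  · obtain ⟨r, rfl⟩ := Nat.exists_eq_add_of_le hst
    rw [Nat.add_comm, Function.iterate_add_apply, h1]
    exact h4 r (by omega)

theorem SafeRun.fits_end {P : Program} {ω : ℕ → Bool} {B : ℕ} {c c' : Config} {t : ℕ}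
    (h : SafeRun P ω B c t c') : c'.Fits B := h.1 ▸ h.2 t le_rfl

theorem SafeRun.single {P : Program} {ω : ℕ → Bool} {B : ℕ} {c : Config} {i : Instr}
    (hi : P[c.pc]? = some i) (h : c.Fits B) (h' : (i.exec ω c).Fits B) :
    SafeRun P ω B c 1 (i.exec ω c) := by
  have hs : step P ω c = i.exec ω c := by simp [step, hi]
  refine ⟨by simpa using hs, fun s hs' => ?_⟩
  interval_cases s
  · exact h
  · simpa [hs] using h'

theorem Config.Fits.update_reg {B : ℕ} {c : Config} (h : c.Fits B) {v : ℕ} (hv : v ≤ B)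
    (d pc coins : ℕ) :
    Config.Fits B { pc := pc, reg := Function.update c.reg d v, mem := c.mem, coins := coins } := by
  refine ⟨fun i => ?_, h.2⟩
  by_cases hi : i = d
  · subst hi; simpa using hv
  · simpa [hi] using h.1 i

theorem Config.Fits.update_mem {B : ℕ} {c : Config} (h : c.Fits B) {v : ℕ} (hv : v ≤ B)
    (d pc coins : ℕ) :
    Config.Fits B { pc := pc, reg := c.reg, mem := Function.update c.mem d v, coins := coins } := by
  refine ⟨h.1, fun i => ?_⟩
  by_cases hi : i = d
  · subst hi; simpa using hv
  · simpa [hi] using h.2 i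

/-- The instructions `l` stand in the program `P` from number `pc` on. -/
def HasCode (P : Program) (pc : ℕ) (l : List Instr) : Prop :=
  ∀ k < l.length, P[pc + k]? = l[k]?

theorem HasCode.left {P : Program} {pc : ℕ} {l₁ l₂ : List Instr}
    (h : HasCode P pc (l₁ ++ l₂)) : HasCode P pc l₁ := fun k hk => by
  rw [h k (by simp; omega), List.getElem?_append_left hk]

theorem HasCode.right {P : Program} {pc : ℕ} {l₁ l₂ : List Instr}
    (h : HasCode P pc (l₁ ++ l₂)) : HasCode P (pc + l₁.length) l₂ := fun k hk => by
  rw [Nat.add_assoc, h _ (by simp; omega), List.getElem?_append_right (by omega)]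
  congr 1; omega

theorem HasCode.head {P : Program} {pc : ℕ} {i : Instr} {l : List Instr}
    (h : HasCode P pc (i :: l)) : P[pc]? = some i := by
  simpa using h 0 (by simp)

theorem HasCode.tail {P : Program} {pc : ℕ} {i : Instr} {l : List Instr}
    (h : HasCode P pc (i :: l)) : HasCode P (pc + 1) l :=
  HasCode.right (l₁ := [i]) h

theorem hasCode_self (l₁ l₂ l₃ : List Instr) : HasCode (l₁ ++ l₂ ++ l₃) l₁.length l₂ := by
  intro k hk
  rw [List.append_assoc, List.getElem?_append_right (by omega),
    List.getElem?_append_left (by omega)]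
  congr 1; omega

/-! ### Compilation of arithmetic expressions -/

/-- Arithmetic expressions in registers and memory cells. -/
inductive Expr
  | lit (c : ℕ)
  | reg (r : ℕ)
  | op (f : Op) (a b : Expr)
  | load (a : Expr)

namespace Expr

/-- The value of an expression for register contents `R` and memory contents `M`. -/
def eval (R M : ℕ → ℕ) : Expr → ℕ
  | lit c => c
  | reg r => R r
  | op f a b => f.eval (a.eval R M) (b.eval R M)
  | load a => M (a.eval R M)

/-- All values that arise from literals and operations during the evaluation are at most `B`.
(The contents of registers and memory cells are bounded by `Config.Fits`.) -/
def Bounded (R M : ℕ → ℕ) (B : ℕ) : Expr → Prop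
  | lit c => c ≤ B
  | reg _ => True
  | op f a b => a.Bounded R M B ∧ b.Bounded R M B ∧ f.eval (a.eval R M) (b.eval R M) ≤ B
  | load a => a.Bounded R M B

/-- The expression mentions only registers with numbers below `d`. -/
def RegsBelow (d : ℕ) : Expr → Prop
  | lit _ => True
  | reg r => r < d
  | op _ a b => a.RegsBelow d ∧ b.RegsBelow d
  | load a => a.RegsBelow d

/-- Code that puts the value of the expression into register `d`, with registers from `d` on as
scratch space. -/
def compile : Expr → ℕ → List Instr
  | lit c, d => [.const d c]
  | reg r, d => [.const d 0, .arith .add d r d]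
  | op f a b, d => a.compile d ++ b.compile (d + 1) ++ [.arith f d d (d + 1)]
  | load a, d => a.compile d ++ [.load d d]

theorem RegsBelow.mono {d d' : ℕ} (h : d ≤ d') : ∀ {e : Expr}, e.RegsBelow d → e.RegsBelow d'
  | lit _, _ => trivial
  | reg _, hr => lt_of_lt_of_le hr h
  | op _ _ _, hr => ⟨hr.1.mono h, hr.2.mono h⟩
  | load a, hr => RegsBelow.mono (e := a) h hr

theorem RegsBelow.eval_congr {d : ℕ} {R R' M : ℕ → ℕ} (h : ∀ r < d, R r = R' r) :
    ∀ {e : Expr}, e.RegsBelow d → e.eval R M = e.eval R' M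
  | lit _, _ => rfl
  | reg r, hr => h r hr
  | op f a b, hr => by simp only [eval]; rw [hr.1.eval_congr h, hr.2.eval_congr h]
  | load a, hr => by simp only [eval]; rw [RegsBelow.eval_congr (e := a) h hr]

theorem RegsBelow.bounded_congr {d B : ℕ} {R R' M : ℕ → ℕ} (h : ∀ r < d, R r = R' r) :
    ∀ {e : Expr}, e.RegsBelow d → (e.Bounded R M B ↔ e.Bounded R' M B)
  | lit _, _ => Iff.rfl
  | reg _, _ => Iff.rfl
  | op f a b, hr => by
      simp only [Bounded]
      rw [hr.1.bounded_congr h, hr.2.bounded_congr h, hr.1.eval_congr h, hr.2.eval_congr h]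
  | load a, hr => RegsBelow.bounded_congr (e := a) h hr

theorem flip_notMem_compile (e : Expr) (d r : ℕ) : Instr.flip r ∉ e.compile d := by
  induction e generalizing d <;> simp_all [compile]

/-- Compiled code computes the value of the expression and leaves the memory and the registers
below `d` alone. -/
theorem compile_correct {P : Program} {ω : ℕ → Bool} {B : ℕ} (e : Expr) :
    ∀ {d : ℕ} {c : Config}, HasCode P c.pc (e.compile d) → e.RegsBelow d → c.Fits B →
    e.Bounded c.reg c.mem B →
    ∃ c', SafeRun P ω B c (e.compile d).length c' ∧ c'.pc = c.pc + (e.compile d).length ∧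
      c'.mem = c.mem ∧ c'.coins = c.coins ∧ c'.reg d = e.eval c.reg c.mem ∧
      ∀ r < d, c'.reg r = c.reg r := by
  induction e with
  | lit v =>
    intro d c hc _ hf hb
    refine ⟨_, SafeRun.single hc.head hf (hf.update_reg hb _ _ _), rfl, rfl, rfl, ?_, ?_⟩
    · simp [Instr.exec, eval]
    · intro r hr
      simp [Instr.exec, hr.ne]
  | reg r =>
    intro d c hc hr hf _
    have hr' : r < d := hr
    have h1 := SafeRun.single (ω := ω) hc.head hf (hf.update_reg (Nat.zero_le _) _ _ _)
    have h2 := SafeRun.single (ω := ω) (c := Instr.exec ω c (.const d 0)) hc.tail.head h1.fits_end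
      (h1.fits_end.update_reg
        (by simpa [Instr.exec, Op.eval, hr'.ne] using hf.1 r) _ _ _)
    refine ⟨_, h1.trans h2, rfl, rfl, rfl, ?_, ?_⟩
    · simp [Instr.exec, eval, Op.eval, hr'.ne]
    · intro r hr
      simp [Instr.exec, hr.ne]
  | op f a b iha ihb =>
    intro d c hc hr hf hb
    obtain ⟨c₁, s₁, p₁, m₁, k₁, v₁, u₁⟩ := iha (hc.left.left) hr.1 hf hb.1
    have hreg : ∀ r < d, c.reg r = c₁.reg r := fun r hr => (u₁ r hr).symm
    obtain ⟨c₂, s₂, p₂, m₂, k₂, v₂, u₂⟩ := ihb (d := d + 1) (c := c₁)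
      (by rw [p₁]; exact hc.left.right) (hr.2.mono (Nat.le_succ d)) s₁.fits_end
      (by rw [m₁]; exact (hr.2.bounded_congr hreg).1 hb.2.1)
    have hv : f.eval (c₂.reg d) (c₂.reg (d + 1)) =
        f.eval (a.eval c.reg c.mem) (b.eval c.reg c.mem) := by
      rw [v₂, u₂ d (Nat.lt_succ_self d), v₁, m₁, hr.2.eval_congr hreg]
    have h3 := SafeRun.single (ω := ω) (c := c₂) (i := .arith f d d (d + 1))
      (by
        rw [p₂, p₁]
        have := hc.right.head
        rwa [List.length_append, ← Nat.add_assoc] at this)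
      s₂.fits_end (s₂.fits_end.update_reg (by rw [hv]; exact hb.2.2) _ _ _)
    refine ⟨_, by simpa [compile, Nat.add_assoc] using (s₁.trans s₂).trans h3, ?_, ?_, ?_, ?_, ?_⟩
    · simp [Instr.exec, p₂, p₁, compile, Nat.add_assoc]
    · simp [Instr.exec, m₂, m₁]
    · simp [Instr.exec, k₂, k₁]
    · simp [Instr.exec, eval, hv]
    · intro r hr
      simp [Instr.exec, hr.ne, u₂ r (by omega), u₁ r hr]
  | load a iha =>
    intro d c hc hr hf hb
    obtain ⟨c₁, s₁, p₁, m₁, k₁, v₁, u₁⟩ := iha hc.left hr hf hb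
    have h3 := SafeRun.single (ω := ω) (c := c₁) (i := .load d d)
      (by rw [p₁]; exact hc.right.head)
      s₁.fits_end (s₁.fits_end.update_reg (s₁.fits_end.2 _) _ _ _)
    refine ⟨_, by simpa [compile] using s₁.trans h3, ?_, ?_, ?_, ?_, ?_⟩
    · simp [Instr.exec, p₁, compile, Nat.add_assoc]
    · simp [Instr.exec, m₁]
    · simp [Instr.exec, k₁]
    · simp [Instr.exec, eval, v₁, m₁]
    · intro r hr
      simp [Instr.exec, hr.ne, u₁ r hr]

end Expr

end WordRAM

/-! ### Running a program on a shifted copy of the memory -/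

namespace WordRAM

theorem SafeRun.of_halted {P : Program} {ω : ℕ → Bool} {B : ℕ} {c : Config}
    (hc : c.Halted P) (h : c.Fits B) (t : ℕ) : SafeRun P ω B c t c := by
  have hs : step P ω c = c := by
    have : P[c.pc]? = none := List.getElem?_eq_none hc
    simp [step, this]
  have := fun t => Function.iterate_fixed hs t
  exact ⟨this t, fun s _ => by rw [this s]; exact h⟩

/-- The instruction mentions only registers with numbers below `K`. -/
def Instr.RegsBelow (K : ℕ) : Instr → Prop
  | .const d _ => d < K
  | .arith _ d a b => d < K ∧ a < K ∧ b < K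
  | .load d a => d < K ∧ a < K
  | .store a s => a < K ∧ s < K
  | .jumpIfZero a _ => a < K
  | .flip d => d < K

theorem Instr.RegsBelow.mono {K K' : ℕ} (h : K ≤ K') {i : Instr} (hi : i.RegsBelow K) :
    i.RegsBelow K' := by
  cases i <;> simp only [Instr.RegsBelow] at hi ⊢ <;> omega

theorem exists_regsBelow (p : Program) : ∃ K, 0 < K ∧ ∀ i ∈ p, i.RegsBelow K := by
  induction p with
  | nil => exact ⟨1, one_pos, by simp⟩
  | cons i p ih =>
    obtain ⟨K, hK, h⟩ := ih
    have hi : ∃ K', i.RegsBelow K' := by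
      cases i with
      | const d _ => exact ⟨d + 1, Nat.lt_succ_self d⟩
      | arith _ d a b => exact ⟨d + a + b + 1, by simp only [Instr.RegsBelow]; omega⟩
      | load d a => exact ⟨d + a + 1, by simp only [Instr.RegsBelow]; omega⟩
      | store a s => exact ⟨a + s + 1, by simp only [Instr.RegsBelow]; omega⟩
      | jumpIfZero a _ => exact ⟨a + 1, Nat.lt_succ_self a⟩
      | flip d => exact ⟨d + 1, Nat.lt_succ_self d⟩
    obtain ⟨K', hK'⟩ := hi
    refine ⟨K + K', by omega, fun j hj => ?_⟩
    rcases List.mem_cons.1 hj with rfl | hj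
    · exact hK'.mono (by omega)
    · exact (h j hj).mono (by omega)

/-- The register in which an instruction expects a memory address, `0` if there is none. -/
def Instr.addrReg : Instr → ℕ
  | .load _ a => a
  | .store a _ => a
  | _ => 0

/-- An instruction with its memory address taken from register `K + 2`, and with the program
counter transformed by `n ↦ base + 2 * n`. -/
def Instr.relocate (K base : ℕ) : Instr → Instr
  | .load d _ => .load d (K + 2)
  | .store _ s => .store (K + 2) s
  | .jumpIfZero a t => .jumpIfZero a (base + 2 * t)
  | i => i

/-- The program `p`, placed from number `base` on, with all memory addresses shifted by the content
of register `K`. Every instruction of `p` becomes exactly two instructions. -/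
def shiftMem (K base : ℕ) (p : Program) : List Instr :=
  p.flatMap fun i => [.arith .add (K + 2) i.addrReg K, i.relocate K base]

theorem length_shiftMem (K base : ℕ) (p : Program) : (shiftMem K base p).length = 2 * p.length := by
  simp [shiftMem, List.length_flatMap, Nat.mul_comm]

theorem getElem?_shiftMem {K base : ℕ} {p : Program} {k : ℕ} {i : Instr} (h : p[k]? = some i) :
    (shiftMem K base p)[2 * k]? = some (.arith .add (K + 2) i.addrReg K) ∧
      (shiftMem K base p)[2 * k + 1]? = some (i.relocate K base) := by
  induction p generalizing k with
  | nil => simp at h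
  | cons j p ih =>
    cases k with
    | zero =>
      obtain rfl : j = i := by simpa using h
      simp [shiftMem]
    | succ k =>
      have := ih (k := k) (by simpa using h)
      simpa [shiftMem, Nat.mul_add, List.getElem?_cons_succ] using this

/-- The configuration `c` represents the configuration `cp` of `p`, with the memory shifted by
`off`. -/
structure Simulates (K base off : ℕ) (cp c : Config) : Prop where
  pc : c.pc = base + 2 * cp.pc
  reg : ∀ i < K, c.reg i = cp.reg i
  reg_off : c.reg K = off
  mem : ∀ i, c.mem (off + i) = cp.mem i
  coins : c.coins = cp.coins

/-- Two steps of the program with shifted memory simulate one step of `p`. Register `K + 2` is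
free to hold the shifted address because `p` mentions only registers below `K`. -/
theorem Simulates.step {K base off B B' : ℕ} {p P : Program} {ω : ℕ → Bool} {cp c : Config}
    (hcode : HasCode P base (shiftMem K base p)) (hlen : P.length = base + 2 * p.length)
    (hK : 0 < K) (hp : ∀ i ∈ p, i.RegsBelow K) (hB : B' + off ≤ B)
    (h : Simulates K base off cp c) (hfp : cp.Fits B') (hfp' : (step p ω cp).Fits B')
    (hf : c.Fits B) :
    ∃ c', SafeRun P ω B c 2 c' ∧ Simulates K base off (step p ω cp) c' := by
  rcases hi : p[cp.pc]? with _ | i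
  · have hs : WordRAM.step p ω cp = cp := by simp [WordRAM.step, hi]
    have hh : p.length ≤ cp.pc := List.getElem?_eq_none_iff.1 hi
    rw [hs]
    exact ⟨c, SafeRun.of_halted (by simp only [Config.Halted, hlen, h.pc]; omega) hf 2, h⟩
  · have hs : WordRAM.step p ω cp = i.exec ω cp := by simp [WordRAM.step, hi]
    rw [hs] at hfp' ⊢
    have hil := (List.getElem?_eq_some_iff.1 hi).1
    have hik := hp i (List.mem_of_getElem? hi)
    obtain ⟨e1, e2⟩ := getElem?_shiftMem (K := K) (base := base) hi
    rw [← hcode _ (by rw [length_shiftMem]; omega)] at e1 e2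
    have hak : i.addrReg < K := by
      cases i <;> simp only [Instr.addrReg, Instr.RegsBelow] at hik ⊢ <;> omega
    have haddr : c.reg i.addrReg + c.reg K = off + cp.reg i.addrReg := by
      rw [h.reg _ hak, h.reg_off]; omega
    have h1 := SafeRun.single (ω := ω) (c := c) (by rw [h.pc]; exact e1) hf
      (hf.update_reg (v := c.reg i.addrReg + c.reg K) (by
        have := hfp.1 i.addrReg
        omega) _ _ _)
    have key : Simulates K base off (i.exec ω cp)
        ((i.relocate K base).exec ω (Instr.exec ω c (.arith .add (K + 2) i.addrReg K))) ∧
        ((i.relocate K base).exec ω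
          (Instr.exec ω c (.arith .add (K + 2) i.addrReg K))).Fits B := by
      have hne : ∀ {r}, r < K → r ≠ K + 2 := by omega
      have upd : ∀ {d v : ℕ}, d < K →
          (∀ r < K, Function.update (Function.update c.reg (K + 2)
            (c.reg i.addrReg + c.reg K)) d v r = Function.update cp.reg d v r) ∧
          Function.update (Function.update c.reg (K + 2)
            (c.reg i.addrReg + c.reg K)) d v K = off := by
        intro d v hd
        constructor
        · intro r hr
          by_cases hrd : r = d
          · subst hrd; simp
          · simp [hrd, hne hr, h.reg r hr]
        · simp [hd.ne', h.reg_off]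
      have hpc := h.pc
      have hval : ∀ {d v pc coins : ℕ} {m : ℕ → ℕ}, d < K →
          Config.Fits B' { pc := pc, reg := Function.update cp.reg d v, mem := m, coins := coins } →
          v ≤ B := by
        intro d v pc coins m hd hv
        have := hv.1 d
        simp at this
        omega
      cases i with
      | const d v =>
        have u := upd (v := v) hik
        exact ⟨⟨by simp [Instr.exec, Instr.relocate]; omega, u.1, u.2, h.mem, h.coins⟩,
          h1.fits_end.update_reg (hval hik hfp') _ _ _⟩
      | arith f d a b =>
        have ev : f.eval (Function.update c.reg (K + 2) (c.reg 0 + c.reg K) a)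
            (Function.update c.reg (K + 2) (c.reg 0 + c.reg K) b) =
            f.eval (cp.reg a) (cp.reg b) := by
          simp [hne hik.2.1, hne hik.2.2, h.reg a hik.2.1, h.reg b hik.2.2]
        have u := upd (v := f.eval (cp.reg a) (cp.reg b)) hik.1
        simp only [Instr.exec, Instr.relocate, Instr.addrReg, Op.eval] at ev u ⊢
        rw [ev]
        exact ⟨⟨by simp only; omega, u.1, u.2, h.mem, h.coins⟩,
          h1.fits_end.update_reg (hval hik.1 hfp') _ _ _⟩
      | load d a =>
        have hm : c.mem (c.reg a + c.reg K) = cp.mem (cp.reg a) := haddr ▸ h.mem _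
        have u := upd (v := cp.mem (cp.reg a)) hik.1
        simp only [Instr.exec, Instr.relocate, Instr.addrReg, Op.eval, Function.update_self] at u ⊢
        rw [hm]
        exact ⟨⟨by simp only; omega, u.1, u.2, h.mem, h.coins⟩,
          h1.fits_end.update_reg (hval hik.1 hfp') _ _ _⟩
      | store a s =>
        have es : Function.update c.reg (K + 2) (c.reg a + c.reg K) s = cp.reg s := by
          simp [hne hik.2, h.reg s hik.2]
        simp only [Instr.exec, Instr.relocate, Instr.addrReg, Op.eval,
          Function.update_self] at haddr ⊢
        rw [es]
        refine ⟨⟨by simp only; omega, fun r hr => ?_, ?_, fun j => ?_, h.coins⟩,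
          h1.fits_end.update_mem ?_ _ _ _⟩
        · simp [hne hr, h.reg r hr]
        · simp [h.reg_off]
        · simp only [haddr]
          by_cases hj : j = cp.reg a
          · subst hj; simp
          · simp [hj, h.mem]
        · exact (hfp.1 s).trans (by omega)
      | jumpIfZero a t =>
        have ea : Function.update c.reg (K + 2) (c.reg 0 + c.reg K) a = cp.reg a := by
          simp [hne hik, h.reg a hik]
        simp only [Instr.exec, Instr.relocate, Instr.addrReg, Op.eval]
        refine ⟨⟨?_, fun r hr => ?_, ?_, h.mem, h.coins⟩, h1.fits_end.1, h1.fits_end.2⟩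
        · simp only [ea]
          split_ifs <;> omega
        · simp [hne hr, h.reg r hr]
        · simp [h.reg_off]
      | flip d =>
        have u := upd (v := (ω cp.coins).toNat) hik
        simp only [Instr.exec, Instr.relocate, Instr.addrReg, Op.eval] at u ⊢
        rw [h.coins]
        exact ⟨⟨by simp only; omega, u.1, u.2, h.mem, rfl⟩,
          h1.fits_end.update_reg (hval hik hfp') _ _ _⟩
    refine ⟨_, h1.trans (SafeRun.single (i := i.relocate K base) ?_ h1.fits_end key.2), key.1⟩
    simp only [Instr.exec, h.pc]
    rw [← e2, Nat.add_assoc]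

theorem Simulates.iterate {K base off B B' : ℕ} {p P : Program} {ω : ℕ → Bool} {cp c : Config}
    (hcode : HasCode P base (shiftMem K base p)) (hlen : P.length = base + 2 * p.length)
    (hK : 0 < K) (hp : ∀ i ∈ p, i.RegsBelow K) (hB : B' + off ≤ B)
    (h : Simulates K base off cp c) (hf : c.Fits B) (t : ℕ)
    (hfp : ∀ s ≤ t, ((WordRAM.step p ω)^[s] cp).Fits B') :
    ∃ c', SafeRun P ω B c (2 * t) c' ∧ Simulates K base off ((WordRAM.step p ω)^[t] cp) c' := by
  induction t with
  | zero => exact ⟨c, SafeRun.refl hf, h⟩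
  | succ t ih =>
    obtain ⟨c₁, s₁, h₁⟩ := ih fun s hs => hfp s (by omega)
    have hlast := hfp (t + 1) le_rfl
    rw [Function.iterate_succ_apply'] at hlast ⊢
    obtain ⟨c₂, s₂, h₂⟩ := h₁.step hcode hlen hK hp hB (hfp t (by omega)) hlast s₁.fits_end
    exact ⟨c₂, s₁.trans s₂, h₂⟩

theorem flip_notMem_shiftMem {K base : ℕ} {p : Program} (hp : ∀ i ∈ p, ∀ dst, i ≠ Instr.flip dst)
    (r : ℕ) : Instr.flip r ∉ shiftMem K base p := by
  simp only [shiftMem, List.mem_flatMap, not_exists, not_and]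
  intro i hi h
  have := hp i hi r
  cases i <;> simp_all [Instr.relocate]

/-! ### Tabulating a word and running a program on it -/

/-- The loop body that stores the value of `letter` behind the input, at the position given by
the counter in register `K + 1`, increases the counter and leaves in register `K + 2` whether it
has reached the value of `size`. -/
def tabulateBody (K : ℕ) (size letter : Expr) : List Instr :=
  Expr.compile (.op .add (.reg K) (.reg (K + 1))) (K + 2) ++
  (letter.compile (K + 3) ++
  ([.store (K + 2) (K + 3), .const (K + 2) 1, .arith .add (K + 1) (K + 1) (K + 2)] ++
  Expr.compile (.op .sub (.lit 1) (.op .sub size (.reg (K + 1)))) (K + 2)))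

/-- Code that puts the value of `size` into register `0`. -/
def tabulateEnd (K : ℕ) (size : Expr) : List Instr :=
  size.compile (K + 2) ++ [.const (K + 3) 0, .arith .add 0 (K + 2) (K + 3)]

/-- The part of `tabulateThen` before the given program. -/
def tabulate (K : ℕ) (size letter : Expr) : List Instr :=
  [.arith .add K 0 K] ++ (tabulateBody K size letter ++
    (.jumpIfZero (K + 2) 1 :: tabulateEnd K size))

/-- The program that runs `p` on the word of length `size` whose letter number `q` is the value of
`letter` when register `K` holds the length of the input and register `K + 1` holds `q`. The word is
stored behind the input, which stays intact. -/
def tabulateThen (K : ℕ) (size letter : Expr) (p : Program) : Program :=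
  tabulate K size letter ++ shiftMem K (tabulate K size letter).length p

/-- What holds at the beginning of the `q`-th round of the loop. -/
structure LoopInv (K : ℕ) (x : List ℕ) (g : ℕ → ℕ) (q : ℕ) (c : Config) : Prop where
  reg_zero : c.reg 0 = x.length
  reg_lt : ∀ i < K, i ≠ 0 → c.reg i = 0
  reg_len : c.reg K = x.length
  reg_ctr : c.reg (K + 1) = q
  mem_input : ∀ i < x.length, c.mem i = x.getD i 0
  mem_word : ∀ i, c.mem (x.length + i) = if i < q then g i else 0
  coins : c.coins = 0

/-- One round of the loop stores the next letter. In register `K + 2`, it leaves `1` if the word is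
complete and `0` otherwise, by truncated subtraction. -/
theorem tabulateBody_correct {K n B : ℕ} {size letter : Expr} {P : Program} {ω : ℕ → Bool}
    {x : List ℕ} {g : ℕ → ℕ} (hK : 0 < K) (hsr : size.RegsBelow (K + 2))
    (hlr : letter.RegsBelow (K + 2)) (hnB : x.length + n ≤ B) (h1B : 1 ≤ B)
    (hsize : ∀ R M : ℕ → ℕ, R K = x.length → (∀ i < x.length, M i = x.getD i 0) →
      size.eval R M = n ∧ size.Bounded R M B)
    (hletter : ∀ (R M : ℕ → ℕ) (q : ℕ), q < n → R K = x.length → R (K + 1) = q →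
      (∀ i < x.length, M i = x.getD i 0) → letter.eval R M = g q ∧ letter.Bounded R M B)
    {q : ℕ} (hq : q < n) {c : Config} (hc : LoopInv K x g q c) (hf : c.Fits B)
    (hcode : HasCode P c.pc (tabulateBody K size letter)) :
    ∃ c', SafeRun P ω B c (tabulateBody K size letter).length c' ∧
      c'.pc = c.pc + (tabulateBody K size letter).length ∧ LoopInv K x g (q + 1) c' ∧
      c'.reg (K + 2) = 1 - (n - (q + 1)) := by
  obtain ⟨c₁, s₁, p₁, m₁, k₁, v₁, u₁⟩ := Expr.compile_correct (ω := ω) (B := B) _ hcode.left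
    (by simp [Expr.RegsBelow]) hf
    (by simp only [Expr.Bounded, Expr.eval, Op.eval, hc.reg_len, hc.reg_ctr, true_and]; omega)
  have e₁ := hletter c₁.reg c₁.mem q hq (by rw [u₁ _ (by omega), hc.reg_len])
    (by rw [u₁ _ (by omega), hc.reg_ctr]) (by rw [m₁]; exact hc.mem_input)
  have code₁ := hcode.right
  rw [← p₁] at code₁
  obtain ⟨c₂, s₂, p₂, m₂, k₂, v₂, u₂⟩ := Expr.compile_correct (ω := ω) (B := B) _ code₁.left
    (hlr.mono (by omega)) s₁.fits_end e₁.2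
  have code₂ := code₁.right
  rw [← p₂] at code₂
  have code₃ := code₂.left
  have w₁ : c₂.reg (K + 2) = x.length + q := by
    rw [u₂ _ (by omega), v₁]
    simp [Expr.eval, Op.eval, hc.reg_len, hc.reg_ctr]
  have s₃ := SafeRun.single (ω := ω) code₃.head s₂.fits_end
    (s₂.fits_end.update_mem (s₂.fits_end.1 _) _ _ _)
  have s₄ := SafeRun.single (ω := ω) (c := Instr.exec ω c₂ (.store (K + 2) (K + 3)))
    code₃.tail.head s₃.fits_end (s₃.fits_end.update_reg h1B _ _ _)
  have ctr : c₂.reg (K + 1) = q := by rw [u₂ _ (by omega), u₁ _ (by omega), hc.reg_ctr]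
  have s₅ := SafeRun.single (ω := ω)
    (c := Instr.exec ω (Instr.exec ω c₂ (.store (K + 2) (K + 3))) (.const (K + 2) 1))
    code₃.tail.tail.head s₄.fits_end (s₄.fits_end.update_reg
      (by simp [Instr.exec, Op.eval, ctr]; omega) _ _ _)
  set c₅ := Instr.exec ω (Instr.exec ω (Instr.exec ω c₂ (.store (K + 2) (K + 3)))
    (.const (K + 2) 1)) (.arith .add (K + 1) (K + 1) (K + 2)) with hc₅
  have inv₅ : LoopInv K x g (q + 1) c₅ := by
    have r₅ : ∀ r < K + 1, c₅.reg r = c.reg r := by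
      intro r hr
      rw [← u₁ r (by omega), ← u₂ r (by omega)]
      have h1 : r ≠ K + 1 := by omega
      have h2 : r ≠ K + 2 := by omega
      simp [hc₅, Instr.exec, h1, h2]
    refine ⟨?_, ?_, ?_, ?_, ?_, ?_, ?_⟩
    · rw [r₅ _ (by omega), hc.reg_zero]
    · intro i hi h0
      rw [r₅ _ (by omega), hc.reg_lt i hi h0]
    · rw [r₅ _ (by omega), hc.reg_len]
    · simp [hc₅, Instr.exec, Op.eval, ctr]
    · intro i hi
      have : i ≠ x.length + q := by omega
      simp [hc₅, Instr.exec, w₁, this, m₂, m₁, hc.mem_input i hi]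
    · intro i
      simp only [hc₅, Instr.exec, w₁, m₂, v₂, m₁]
      by_cases hi : i = q
      · subst hi; simp [← m₁, e₁.1]
      · have : i < q + 1 ↔ i < q := by omega
        simp [hi, hc.mem_word, this]
    · simp [hc₅, Instr.exec, k₂, k₁, hc.coins]
  have e₅ := hsize c₅.reg c₅.mem inv₅.reg_len inv₅.mem_input
  have p₅ : c₅.pc = c₂.pc + 3 := rfl
  have code₅ := code₂.right
  rw [show c₂.pc + List.length [Instr.store (K + 2) (K + 3), .const (K + 2) 1,
    .arith .add (K + 1) (K + 1) (K + 2)] = c₅.pc from rfl] at code₅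
  obtain ⟨c₆, s₆, p₆, m₆, k₆, v₆, u₆⟩ := Expr.compile_correct (ω := ω) (B := B) _ code₅
    (by simpa [Expr.RegsBelow] using hsr) s₅.fits_end
    (by
      simp only [Expr.Bounded, Expr.eval, Op.eval, inv₅.reg_ctr, e₅.1]
      exact ⟨h1B, ⟨e₅.2, trivial, by omega⟩, by omega⟩)
  refine ⟨c₆, ?_, ?_, ⟨?_, ?_, ?_, ?_, ?_, ?_, ?_⟩, ?_⟩
  · rw [tabulateBody, List.length_append, List.length_append, List.length_append]
    exact s₁.trans (s₂.trans ((s₃.trans (s₄.trans s₅)).trans s₆))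
  · rw [p₆, p₅, p₂, p₁]
    simp [tabulateBody]
    omega
  · rw [u₆ _ (by omega), inv₅.reg_zero]
  · intro i hi h0
    rw [u₆ _ (by omega), inv₅.reg_lt i hi h0]
  · rw [u₆ _ (by omega), inv₅.reg_len]
  · rw [u₆ _ (by omega), inv₅.reg_ctr]
  · rw [m₆]; exact inv₅.mem_input
  · rw [m₆]; exact inv₅.mem_word
  · rw [k₆, inv₅.coins]
  · rw [v₆]
    simp only [Expr.eval, Op.eval, inv₅.reg_ctr, e₅.1]

/-- The loop, entered when `k + 1` letters are missing, stores all of them. -/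
theorem tabulateLoop_correct {K n B : ℕ} {size letter : Expr} {P : Program} {ω : ℕ → Bool}
    {x : List ℕ} {g : ℕ → ℕ} (hK : 0 < K) (hsr : size.RegsBelow (K + 2))
    (hlr : letter.RegsBelow (K + 2)) (hnB : x.length + n ≤ B) (h1B : 1 ≤ B)
    (hsize : ∀ R M : ℕ → ℕ, R K = x.length → (∀ i < x.length, M i = x.getD i 0) →
      size.eval R M = n ∧ size.Bounded R M B)
    (hletter : ∀ (R M : ℕ → ℕ) (q : ℕ), q < n → R K = x.length → R (K + 1) = q →
      (∀ i < x.length, M i = x.getD i 0) → letter.eval R M = g q ∧ letter.Bounded R M B)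
    (hcode : HasCode P 1 (tabulateBody K size letter))
    (hjump : P[1 + (tabulateBody K size letter).length]? = some (.jumpIfZero (K + 2) 1)) (k : ℕ) :
    ∀ {q : ℕ}, q + (k + 1) = n → ∀ {c : Config}, LoopInv K x g q c → c.Fits B → c.pc = 1 →
    ∃ c', SafeRun P ω B c ((k + 1) * ((tabulateBody K size letter).length + 1)) c' ∧
      c'.pc = 1 + (tabulateBody K size letter).length + 1 ∧ LoopInv K x g n c' := by
  induction k with
  | zero =>
    intro q hq c hc hf hpc
    obtain ⟨c₁, s₁, p₁, i₁, v₁⟩ := tabulateBody_correct (ω := ω) hK hsr hlr hnB h1B hsize hletter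
      (by omega) hc hf (by rw [hpc]; exact hcode)
    rw [hpc] at p₁
    have s₂ := SafeRun.single (ω := ω) (i := .jumpIfZero (K + 2) 1) (by rw [p₁]; exact hjump)
      s₁.fits_end
      ⟨s₁.fits_end.1, s₁.fits_end.2⟩
    have hz : c₁.reg (K + 2) ≠ 0 := by omega
    refine ⟨_, by simpa using s₁.trans s₂, by simp [Instr.exec, hz, p₁], ?_⟩
    obtain rfl : q + 1 = n := by omega
    exact ⟨i₁.1, i₁.2, i₁.3, i₁.4, i₁.5, i₁.6, i₁.7⟩
  | succ k ih =>
    intro q hq c hc hf hpc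
    obtain ⟨c₁, s₁, p₁, i₁, v₁⟩ := tabulateBody_correct (ω := ω) hK hsr hlr hnB h1B hsize hletter
      (by omega) hc hf (by rw [hpc]; exact hcode)
    rw [hpc] at p₁
    have s₂ := SafeRun.single (ω := ω) (i := .jumpIfZero (K + 2) 1) (by rw [p₁]; exact hjump)
      s₁.fits_end
      ⟨s₁.fits_end.1, s₁.fits_end.2⟩
    have hz : c₁.reg (K + 2) = 0 := by omega
    obtain ⟨c₃, s₃, p₃, i₃⟩ := ih (q := q + 1) (by omega)
      (c := Instr.exec ω c₁ (.jumpIfZero (K + 2) 1))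
      ⟨i₁.1, i₁.2, i₁.3, i₁.4, i₁.5, i₁.6, i₁.7⟩ s₂.fits_end (by simp [Instr.exec, hz])
    refine ⟨c₃, ?_, p₃, i₃⟩
    have := (s₁.trans s₂).trans s₃
    rwa [show (k + 1 + 1) * ((tabulateBody K size letter).length + 1) =
      (tabulateBody K size letter).length + 1 +
        (k + 1) * ((tabulateBody K size letter).length + 1) by ring]

/-- The number of steps that `tabulateThen` needs for a word of length `n` and `t` steps of the
given program. -/
def tabulateTime (K : ℕ) (size letter : Expr) (n t : ℕ) : ℕ :=
  1 + n * ((tabulateBody K size letter).length + 1) + (tabulateEnd K size).length + 2 * t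

theorem length_tabulate (K : ℕ) (size letter : Expr) : (tabulate K size letter).length =
    1 + (tabulateBody K size letter).length + 1 + (tabulateEnd K size).length := by
  simp [tabulate]; omega

/-- `tabulateThen` on the input `x` behaves like the given program on the tabulated word. -/
theorem tabulateThen_correct {K n B B' : ℕ} {size letter : Expr} {p : Program} {ω : ℕ → Bool}
    {x : List ℕ} {g : ℕ → ℕ} (hK : 0 < K) (hp : ∀ i ∈ p, i.RegsBelow K)
    (hsr : size.RegsBelow (K + 2)) (hlr : letter.RegsBelow (K + 2)) (hn : 0 < n)
    (hnB : x.length + n ≤ B) (hxB : ∀ v ∈ x, v ≤ B) (hB : B' + x.length ≤ B)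
    (hsize : ∀ R M : ℕ → ℕ, R K = x.length → (∀ i < x.length, M i = x.getD i 0) →
      size.eval R M = n ∧ size.Bounded R M B)
    (hletter : ∀ (R M : ℕ → ℕ) (q : ℕ), q < n → R K = x.length → R (K + 1) = q →
      (∀ i < x.length, M i = x.getD i 0) → letter.eval R M = g q ∧ letter.Bounded R M B)
    (t : ℕ) (hfp : ∀ s ≤ t, (run p ω ((List.range n).map g) s).Fits B') :
    ((run (tabulateThen K size letter p) ω x (tabulateTime K size letter n t)).Halted
        (tabulateThen K size letter p) ↔ (run p ω ((List.range n).map g) t).Halted p) ∧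
      ((run (tabulateThen K size letter p) ω x (tabulateTime K size letter n t)).Accepting ↔
        (run p ω ((List.range n).map g) t).Accepting) ∧
      ∀ s ≤ tabulateTime K size letter n t,
        (run (tabulateThen K size letter p) ω x s).Fits B := by
  set P := tabulateThen K size letter p with hP
  have code : HasCode P 0 (tabulate K size letter) :=
    hasCode_self [] (tabulate K size letter) (shiftMem K (tabulate K size letter).length p)
  have code' : HasCode P (tabulate K size letter).length
      (shiftMem K (tabulate K size letter).length p) := by
    have := hasCode_self (tabulate K size letter)
      (shiftMem K (tabulate K size letter).length p) []
    simpa [hP, tabulateThen] using this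
  have hlen : P.length = (tabulate K size letter).length + 2 * p.length := by
    simp [hP, tabulateThen, length_shiftMem]
  have hf₀ : (init x).Fits B := by
    refine ⟨fun i => ?_, fun i => ?_⟩
    · simp only [init]
      split_ifs <;> omega
    · simp only [init]
      rcases lt_or_ge i x.length with hi | hi
      · rw [List.getD_eq_getElem _ _ hi]
        exact hxB _ (List.getElem_mem hi)
      · rw [List.getD_eq_default _ _ hi]
        exact Nat.zero_le _
  have s₁ := SafeRun.single (ω := ω) (c := init x) (i := .arith .add K 0 K) code.left.head hf₀
    (hf₀.update_reg (by simp [init, Op.eval, hK.ne']; omega) _ _ _)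
  set c₁ := Instr.exec ω (init x) (.arith .add K 0 K) with hc₁
  have i₁ : LoopInv K x g 0 c₁ := by
    refine ⟨?_, fun i hi h0 => ?_, ?_, ?_, fun i _ => ?_, fun i => ?_, ?_⟩
    · simp [hc₁, Instr.exec, init, hK.ne]
    · simp [hc₁, Instr.exec, init, hi.ne, h0]
    · simp [hc₁, Instr.exec, init, hK.ne', Op.eval]
    · simp [hc₁, Instr.exec, init]
    · simp [hc₁, Instr.exec, init]
    · simp [hc₁, Instr.exec, init]
    · simp [hc₁, Instr.exec, init]
  have code₁ := code.right
  obtain ⟨k, rfl⟩ : ∃ k, n = k + 1 := ⟨n - 1, by omega⟩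
  obtain ⟨c₂, s₂, p₂, i₂⟩ := tabulateLoop_correct (ω := ω) hK hsr hlr hnB (by omega) hsize hletter
    code₁.left code₁.right.head k (q := 0) (by omega) i₁ s₁.fits_end rfl
  have code₂ := code₁.right.tail
  rw [show 0 + List.length [Instr.arith .add K 0 K] + (tabulateBody K size letter).length + 1 =
      c₂.pc by rw [p₂]; rfl] at code₂
  have e₂ := hsize c₂.reg c₂.mem i₂.reg_len i₂.mem_input
  obtain ⟨c₃, s₃, p₃, m₃, k₃, v₃, u₃⟩ := Expr.compile_correct (ω := ω) size code₂.left hsr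
    s₂.fits_end e₂.2
  have code₃ := code₂.right
  rw [← p₃] at code₃
  have s₄ := SafeRun.single (ω := ω) code₃.head s₃.fits_end
    (s₃.fits_end.update_reg (Nat.zero_le _) _ _ _)
  have s₅ := SafeRun.single (ω := ω) (c := Instr.exec ω c₃ (.const (K + 3) 0)) code₃.tail.head
    s₄.fits_end (s₄.fits_end.update_reg (by simp [Instr.exec, Op.eval, v₃, e₂.1]; omega) _ _ _)
  set c₅ := Instr.exec ω (Instr.exec ω c₃ (.const (K + 3) 0)) (.arith .add 0 (K + 2) (K + 3))
    with hc₅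
  have sim : Simulates K (tabulate K size letter).length x.length
      (init ((List.range (k + 1)).map g)) c₅ := by
    refine ⟨?_, fun i hi => ?_, ?_, fun i => ?_, ?_⟩
    · have : c₅.pc = c₃.pc + 2 := rfl
      rw [this, p₃, p₂, length_tabulate]
      simp [init, tabulateEnd]
      omega
    · have h1 : i ≠ K + 3 := by omega
      have h2 : i ≠ K + 2 := by omega
      by_cases h0 : i = 0
      · subst h0
        simp [hc₅, Instr.exec, Op.eval, init, v₃, e₂.1]
      · simp [hc₅, Instr.exec, init, h0, h1, u₃ i (by omega), i₂.reg_lt i hi h0]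
    · simp [hc₅, Instr.exec, hK.ne', u₃ K (by omega), i₂.reg_len]
    · simp only [hc₅, Instr.exec, init, m₃, i₂.mem_word]
      split_ifs with h
      · rw [List.getD_eq_getElem _ _ (by simpa using h)]
        simp
      · rw [List.getD_eq_default _ _ (by simpa using h)]
    · simp [hc₅, Instr.exec, init, k₃, i₂.coins]
  obtain ⟨c₆, s₆, sim₆⟩ := sim.iterate code' hlen hK hp hB s₅.fits_end t hfp
  have total := (((s₁.trans s₂).trans s₃).trans (s₄.trans s₅)).trans s₆
  rw [show 1 + (k + 1) * ((tabulateBody K size letter).length + 1) + (size.compile (K + 2)).length +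
      (1 + 1) + 2 * t = tabulateTime K size letter (k + 1) t by
    simp [tabulateTime, tabulateEnd]; omega] at total
  have hrun : run P ω x (tabulateTime K size letter (k + 1) t) = c₆ := total.1
  rw [hrun]
  have hpc := sim₆.pc
  have hreg := sim₆.reg 0 hK
  refine ⟨?_, ?_, total.2⟩
  · simp only [Config.Halted, hlen, hpc, run]
    omega
  · simp only [Config.Accepting, hreg, run]

theorem flip_notMem_tabulateThen {K : ℕ} {size letter : Expr} {p : Program}
    (hp : ∀ i ∈ p, ∀ dst, i ≠ Instr.flip dst) :
    ∀ i ∈ tabulateThen K size letter p, ∀ dst, i ≠ Instr.flip dst := by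
  rintro i hi dst rfl
  simp [tabulateThen, tabulate, tabulateBody, tabulateEnd, Expr.flip_notMem_compile,
    flip_notMem_shiftMem hp] at hi

end WordRAM

/-! ### A linear lower bound for finding a letter -/

namespace WordRAM

/-- Events that are determined by finitely many coins are measurable. -/
theorem measurableSet_of_dependsOn_lt {S : Set (ℕ → Bool)} {T : ℕ}
    (h : ∀ ω ω' : ℕ → Bool, (∀ i < T, ω i = ω' i) → ω ∈ S → ω' ∈ S) : MeasurableSet S := by
  let r : (ℕ → Bool) → (Fin T → Bool) := fun ω i => ω i
  have hr : Measurable r := measurable_pi_lambda _ fun i => measurable_pi_apply _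
  have : S = r ⁻¹' (r '' S) := by
    refine Set.Subset.antisymm (Set.subset_preimage_image r S) ?_
    rintro ω ⟨ω', hω', he⟩
    exact h ω' ω (fun i hi => congrFun he ⟨i, hi⟩) hω'
  rw [this]
  exact hr (Set.toFinite _).measurableSet

/-- The first `t` steps of a run depend on at most `t` coins. -/
theorem run_congr_coins {p : Program} {x : List ℕ} {ω ω' : ℕ → Bool} {t : ℕ}
    (h : ∀ i < t, ω i = ω' i) : run p ω x t = run p ω' x t ∧ (run p ω x t).coins ≤ t := by
  induction t with
  | zero => exact ⟨rfl, le_rfl⟩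
  | succ t ih =>
    obtain ⟨h1, h2⟩ := ih fun i hi => h i (by omega)
    simp only [run, Function.iterate_succ_apply'] at h1 h2 ⊢
    rw [← h1]
    set c := (step p ω)^[t] (init x)
    simp only [step]
    rcases p[c.pc]? with _ | i
    · exact ⟨rfl, by simp only; omega⟩
    · cases i <;> simp only [Instr.exec, true_and] <;> try omega
      rw [h c.coins (by omega)]
      exact ⟨rfl, by omega⟩

/-- The content of the register in which the next instruction expects a memory address (an
arbitrary register if it does not access the memory). -/
def addr (p : Program) (c : Config) : ℕ :=
  match p[c.pc]? with
  | none => 0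
  | some i => c.reg i.addrReg

/-- A run does not notice a change of the input at a position that it never addresses. -/
theorem run_eq_of_addr_ne {p : Program} {ω : ℕ → Bool} {x x' : List ℕ} {j T : ℕ}
    (hl : x.length = x'.length) (hx : ∀ i, i ≠ j → x.getD i 0 = x'.getD i 0)
    (hj : ∀ t < T, addr p (run p ω x t) ≠ j) :
    (run p ω x T).pc = (run p ω x' T).pc ∧ (run p ω x T).reg = (run p ω x' T).reg ∧
      (run p ω x T).coins = (run p ω x' T).coins ∧
      ∀ i, i ≠ j → (run p ω x T).mem i = (run p ω x' T).mem i := by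
  induction T with
  | zero => exact ⟨rfl, by simp [run, init, hl], rfl, hx⟩
  | succ T ih =>
    obtain ⟨h1, h2, h3, h4⟩ := ih fun t ht => hj t (by omega)
    have hT := hj T (by omega)
    simp only [run, Function.iterate_succ_apply'] at h1 h2 h3 h4 hT ⊢
    set c := (step p ω)^[T] (init x)
    set c' := (step p ω)^[T] (init x')
    simp only [step, ← h1]
    rcases hi : p[c.pc]? with _ | i
    · exact ⟨h1, h2, h3, h4⟩
    · simp only [addr, hi] at hT
      cases i with
      | load d a =>
        simp only [Instr.exec, h1, ← h2, h3, true_and]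
        have hT' : c.reg a ≠ j := hT
        rw [h4 _ hT']
        exact ⟨rfl, h4⟩
      | store a s =>
        simp only [Instr.exec, h1, h2, h3, true_and]
        intro i hij
        by_cases hia : i = c'.reg a
        · subst hia; simp
        · simp [hia, h4 i hij]
      | _ => simp only [Instr.exec, h1, h2, h3, true_and]; exact h4

instance : IsProbabilityMeasure coinMeasure := by
  unfold coinMeasure
  infer_instance

/-- A program that distinguishes, with probability `2/3`, an input `x` from each of the inputs
obtained from `x` by changing one of `n` positions must run for at least `n/3` steps: in a run on
`x`, each of these positions is addressed with probability at least `1/3`. -/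
theorem le_three_mul_of_distinguishes {p : Program} {x : List ℕ} {y : ℕ → List ℕ} {n T : ℕ}
    (hl : ∀ i < n, x.length = (y i).length)
    (hy : ∀ i < n, ∀ j, j ≠ i → x.getD j 0 = (y i).getD j 0)
    (hx : (2 / 3 : ℝ≥0∞) ≤ coinMeasure {ω | ¬ (run p ω x T).Accepting})
    (hy' : ∀ i < n, (2 / 3 : ℝ≥0∞) ≤ coinMeasure {ω | (run p ω (y i) T).Accepting}) :
    n ≤ 3 * T := by
  set R : ℕ → Set (ℕ → Bool) := fun i => {ω | ∃ t < T, addr p (run p ω x t) = i} with hR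
  have hRm : ∀ i, MeasurableSet (R i) := fun i =>
    measurableSet_of_dependsOn_lt (T := T) fun ω ω' h ⟨t, ht, hi⟩ =>
      ⟨t, ht, by rw [← (run_congr_coins fun k hk => h k (by omega)).1]; exact hi⟩
  have hxm : MeasurableSet {ω | ¬ (run p ω x T).Accepting} :=
    measurableSet_of_dependsOn_lt (T := T) fun ω ω' h hω => by
      rwa [Set.mem_ofPred_eq, ← (run_congr_coins h).1]
  have hRi : ∀ i < n, (1 / 3 : ℝ≥0∞) ≤ coinMeasure (R i) := by
    intro i hi
    have hsub : {ω | ¬ (run p ω x T).Accepting} ∩ {ω | (run p ω (y i) T).Accepting} ⊆ R i := by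
      rintro ω ⟨h1, h2⟩
      by_contra hω
      have := (run_eq_of_addr_ne (ω := ω) (p := p) (T := T) (hl i hi) (hy i hi)
        (by simpa [hR] using hω)).2.1
      simp only [Set.mem_ofPred_eq, Config.Accepting, this] at h1 h2
      exact h1 h2
    have h1 := measure_union_add_inter' (μ := coinMeasure) hxm {ω | (run p ω (y i) T).Accepting}
    have h2 : (2 / 3 : ℝ≥0∞) + 2 / 3 ≤ 1 + coinMeasure (R i) :=
      calc (2 / 3 : ℝ≥0∞) + 2 / 3 ≤ _ := add_le_add hx (hy' i hi)
        _ = _ := h1.symm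
        _ ≤ 1 + coinMeasure (R i) := add_le_add prob_le_one (measure_mono hsub)
    have h3 : (2 / 3 : ℝ≥0∞) + 2 / 3 = 1 + 1 / 3 := by
      calc (2 / 3 : ℝ≥0∞) + 2 / 3 = 3 / 3 + 1 / 3 := by
            rw [ENNReal.div_add_div_same, ENNReal.div_add_div_same]; norm_num
        _ = 1 + 1 / 3 := by rw [ENNReal.div_self (by simp) (by simp)]
    rw [h3] at h2
    exact (ENNReal.add_le_add_iff_left ENNReal.one_ne_top).1 h2
  have hsum : ∑ i ∈ Finset.range n, coinMeasure (R i) ≤ T := by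
    calc ∑ i ∈ Finset.range n, coinMeasure (R i)
        = ∑ i ∈ Finset.range n, ∫⁻ ω, (R i).indicator 1 ω ∂coinMeasure := by
          simp_rw [lintegral_indicator_one (hRm _)]
      _ = ∫⁻ ω, ∑ i ∈ Finset.range n, (R i).indicator 1 ω ∂coinMeasure :=
          (lintegral_finsetSum _ fun i _ => measurable_one.indicator (hRm i)).symm
      _ ≤ ∫⁻ _, (T : ℝ≥0∞) ∂coinMeasure := by
          refine lintegral_mono fun ω => ?_
          classical
          simp only [Set.indicator_apply, Pi.one_apply]
          rw [Finset.sum_boole]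
          norm_cast
          calc _ ≤ ((Finset.range T).image fun t => addr p (run p ω x t)).card := by
                refine Finset.card_le_card fun i hi => ?_
                simpa [hR] using (Finset.mem_filter.1 hi).2
            _ ≤ T := by simpa using Finset.card_image_le (s := Finset.range T)
      _ = T := by simp
  have h4 : (n : ℝ≥0∞) * (1 / 3) ≤ T := by
    refine le_trans ?_ hsum
    have := Finset.card_nsmul_le_sum (Finset.range n) (fun i => coinMeasure (R i)) (1 / 3)
      fun i hi => hRi i (Finset.mem_range.1 hi)
    simpa using this
  have h5 : (n : ℝ≥0∞) ≤ T * 3 := by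
    rwa [mul_one_div, ENNReal.div_le_iff (by simp) (by simp)] at h4
  rw [mul_comm]
  exact_mod_cast h5

end WordRAM

theorem traceEquiv_bot_iff {A : Type*} {u v : List A} :
    TraceEquiv (⊥ : SimpleGraph A) u v ↔ u = v := by
  constructor
  · intro h
    induction h with
    | rel _ _ h => obtain ⟨_, _, _, _, h, _⟩ := h; exact absurd h (by simp)
    | refl => rfl
    | symm _ _ _ ih => exact ih.symm
    | trans _ _ _ _ _ ih₁ ih₂ => exact ih₁.trans ih₂
  · rintro rfl
    exact Relation.EqvGen.refl _

theorem IsStarFree.top {A : Type*} : IsStarFree (⊤ : Language A) := by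
  simpa using (IsStarFree.empty (A := A)).compl

/-- The words over two letters that contain the letter `1`. -/
def containsOne : Language (Fin 2) := ⊤ * {[1]} * ⊤

theorem mem_containsOne {w : List (Fin 2)} : w ∈ containsOne ↔ 1 ∈ w := by
  rw [List.mem_iff_append]
  constructor
  · rintro ⟨_, ⟨u, -, _, rfl, rfl⟩, v, -, rfl⟩
    exact ⟨u, v, by simp⟩
  · rintro ⟨u, v, rfl⟩
    exact ⟨u ++ [1], ⟨u, trivial, [1], rfl, rfl⟩, v, trivial, by simp⟩

/-- The encoding of words in `MonitoringSolvable` is elaborated as a list of coerced letters, to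
which the identity is mapped. -/
theorem monitoringEncoding_eq {s : ℕ} (w : List (Fin s)) :
    (List.map (fun a => a) (do let a ← w; pure (a : ℕ)) : List ℕ) = w.map Fin.val := by
  induction w <;> simp_all

/-- Searching for a letter takes linear time, whatever the coins: the search must distinguish the
word without the letter from the words that contain it exactly once. -/
theorem not_monitoringSolvable_containsOne {m : WordRAM.Mode} {ε : ℝ} (hε : 0 < ε) :
    ¬ MonitoringSolvable m ⊥ containsOne (1 - ε) := by
  rintro ⟨p, T, -, ⟨c, hdec⟩, hT⟩
  simp only [monitoringEncoding_eq] at hdec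
  have key : ∀ n, n ≤ 3 * T n := by
    intro n
    have hiff : ∀ w : List (Fin 2), w ∈ PredictiveMonitoring ⊥ containsOne ↔ 1 ∈ w := by
      intro w
      simp [PredictiveMonitoring, traceEquiv_bot_iff, mem_containsOne]
    refine WordRAM.le_three_mul_of_distinguishes (p := p)
      (x := (List.replicate n (0 : Fin 2)).map Fin.val)
      (y := fun i => ((List.replicate n (0 : Fin 2)).set i 1).map Fin.val)
      (by simp) ?_ ?_ ?_
    · intro i _ j hji
      simp only [List.getD_eq_getElem?_getD, List.getElem?_map, List.getElem?_set_ne hji.symm]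
    · have := (hdec (List.replicate n 0)).2
      simpa only [hiff, List.mem_replicate, one_ne_zero, and_false, iff_false,
        List.length_replicate] using this
    · intro i hi
      have := (hdec ((List.replicate n 0).set i 1)).2
      have hmem : (1 : Fin 2) ∈ (List.replicate n 0).set i 1 :=
        List.mem_set (by simpa using hi) 1
      simpa only [hiff, hmem, iff_true, List.length_replicate, List.length_set] using this
  have h1 : (fun n : ℕ => (n : ℝ)) =O[atTop] (fun n : ℕ => (n : ℝ) ^ (1 - ε)) := by
    refine (Asymptotics.IsBigO.of_bound 3 (Eventually.of_forall fun n => ?_)).trans hT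
    have : (n : ℝ) ≤ 3 * T n := by exact_mod_cast key n
    simpa using this
  have h2 : (fun n : ℕ => (n : ℝ) ^ (1 - ε)) =o[atTop] (fun n : ℕ => (n : ℝ)) := by
    refine (Asymptotics.isLittleO_iff_tendsto' ?_).2 ?_
    · filter_upwards [eventually_gt_atTop 0] with n hn h
      exact absurd h (by exact_mod_cast hn.ne')
    · refine ((tendsto_rpow_neg_atTop hε).comp tendsto_natCast_atTop_atTop).congr' ?_
      filter_upwards [eventually_gt_atTop 0] with n hn
      have hn' : (0 : ℝ) < n := by exact_mod_cast hn
      simp only [Function.comp_apply]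
      rw [sub_eq_add_neg, Real.rpow_add hn', Real.rpow_one, mul_div_cancel_left₀ _ hn'.ne']
  refine Asymptotics.isLittleO_irrefl ?_ (h1.trans_isLittleO h2)
  exact Eventually.frequently ((eventually_gt_atTop 0).mono fun n hn => by
    exact_mod_cast hn.ne')

/-! ### Trace equivalence over a disjoint union of threads -/

theorem TraceEquiv.cons {A : Type*} {I : SimpleGraph A} {u v : List A} (h : TraceEquiv I u v)
    (a : A) : TraceEquiv I (a :: u) (a :: v) := by
  induction h with
  | rel u v h =>
    obtain ⟨w₁, w₂, b, c, hbc, rfl, rfl⟩ := h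
    exact .rel _ _ ⟨a :: w₁, w₂, b, c, hbc, rfl, rfl⟩
  | refl u => exact .refl _
  | symm u v _ ih => exact .symm _ _ ih
  | trans u v w _ _ ih₁ ih₂ => exact .trans _ _ _ ih₁ ih₂

theorem traceEquiv_cons_append {A : Type*} {I : SimpleGraph A} {a : A} {u : List A}
    (h : ∀ b ∈ u, I.Adj a b) (v : List A) : TraceEquiv I (a :: (u ++ v)) (u ++ a :: v) := by
  induction u with
  | nil => exact .refl _
  | cons b u ih =>
    have h1 : TraceEquiv I (a :: b :: (u ++ v)) (b :: a :: (u ++ v)) :=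
      .rel _ _ ⟨[], u ++ v, a, b, h b (by simp), rfl, rfl⟩
    exact .trans _ _ _ h1 ((ih fun c hc => h c (by simp [hc])).cons b)

/-- If exactly the letters in different threads are independent, then a word is determined up to
trace equivalence by its projections to the threads. -/
theorem traceEquiv_comap_top_iff {A ι : Type*} [DecidableEq ι] {th : A → ι} {u v : List A} :
    TraceEquiv (SimpleGraph.comap th ⊤) u v ↔
      ∀ i, u.filter (th · = i) = v.filter (th · = i) := by
  constructor
  · intro h i
    induction h with
    | rel u v h =>
      obtain ⟨w₁, w₂, a, b, hab, rfl, rfl⟩ := h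
      simp only [SimpleGraph.comap_adj, SimpleGraph.top_adj] at hab
      simp only [List.filter_append, List.filter_cons, List.filter_nil, decide_eq_true_eq]
      split_ifs with h1 h2
      · exact absurd (h1.trans h2.symm) hab
      all_goals rfl
    | refl => rfl
    | symm _ _ _ ih => exact ih.symm
    | trans _ _ _ _ _ ih₁ ih₂ => exact ih₁.trans ih₂
  -- The first letter of `u` is the first letter of its thread in `v`, hence it can be moved to the
  -- front of `v`.
  · intro h
    induction u generalizing v with
    | nil =>
      cases v with
      | nil => exact .refl _
      | cons a v => simpa using h (th a)
    | cons a u ih =>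
      have ha := h (th a)
      rw [List.filter_cons_of_pos (by simp)] at ha
      obtain ⟨v₁, v₂, rfl, h₁, -, h₂⟩ := List.filter_eq_cons_iff.1 ha.symm
      have hne : ∀ b ∈ v₁, th a ≠ th b := fun b hb he => h₁ b hb (by simp [he])
      refine .trans _ _ _ (TraceEquiv.cons (ih (v := v₁ ++ v₂) fun i => ?_) a)
        (traceEquiv_cons_append hne v₂)
      by_cases hi : th a = i
      · subst hi
        rw [List.filter_append, List.filter_eq_nil_iff.2 h₁, List.nil_append, h₂]
      · simpa [List.filter_cons, hi] using h i

/-! ### Some star-free languages over finite alphabets -/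

section StarFree

variable {A : Type*}

theorem IsStarFree.finset_sup {ι : Type*} (s : Finset ι) {f : ι → Language A}
    (h : ∀ i ∈ s, IsStarFree (f i)) : IsStarFree (s.sup f) := by
  classical
  induction s using Finset.induction_on with
  | empty => exact .empty
  | insert i s _ ih =>
    rw [Finset.sup_insert]
    exact .union (h i (by simp)) (ih fun j hj => h j (by simp [hj]))

theorem IsStarFree.iSup {ι : Type*} [Finite ι] {f : ι → Language A}
    (h : ∀ i, IsStarFree (f i)) : IsStarFree (⨆ i, f i) := by
  have := Fintype.ofFinite ι
  rw [← Finset.sup_univ_eq_iSup]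
  exact .finset_sup _ fun i _ => h i

theorem Language.mem_iSup' {ι : Sort*} {f : ι → Language A} {w : List A} :
    w ∈ ⨆ i, f i ↔ ∃ i, w ∈ f i := Set.mem_iUnion

/-- The words of length one with letter in `S`. -/
def oneLetter (S : Set A) : Language A := ⨆ a : S, {[(a : A)]}

theorem mem_oneLetter {S : Set A} {w : List A} : w ∈ oneLetter S ↔ ∃ a ∈ S, w = [a] := by
  simp only [oneLetter, Language.mem_iSup', Subtype.exists, exists_prop]
  rfl

theorem isStarFree_oneLetter [Finite A] (S : Set A) : IsStarFree (oneLetter S) :=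
  .iSup fun a => .letter (a : A)

theorem mem_top_mul_mul_top {L : Language A} {w : List A} :
    w ∈ ⊤ * L * ⊤ ↔ ∃ u v x, v ∈ L ∧ w = u ++ v ++ x := by
  constructor
  · rintro ⟨_, ⟨u, -, v, hv, rfl⟩, x, -, rfl⟩
    exact ⟨u, v, x, hv, rfl⟩
  · rintro ⟨u, v, x, hv, rfl⟩
    exact ⟨_, ⟨u, trivial, v, hv, rfl⟩, x, trivial, rfl⟩

/-- The words with all letters in `S`. -/
def allLetters (S : Set A) : Language A := (⊤ * oneLetter Sᶜ * ⊤)ᶜ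

theorem mem_allLetters {S : Set A} {w : List A} : w ∈ allLetters S ↔ ∀ a ∈ w, a ∈ S := by
  have : w ∈ ⊤ * oneLetter Sᶜ * ⊤ ↔ ∃ a ∈ w, a ∉ S := by
    rw [mem_top_mul_mul_top]
    constructor
    · rintro ⟨u, v, x, hv, rfl⟩
      obtain ⟨a, ha, rfl⟩ := mem_oneLetter.1 hv
      exact ⟨a, by simp, ha⟩
    · rintro ⟨a, ha, haS⟩
      obtain ⟨u, x, rfl⟩ := List.mem_iff_append.1 ha
      exact ⟨u, [a], x, mem_oneLetter.2 ⟨a, haS, rfl⟩, by simp⟩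
  have h2 : w ∈ allLetters S ↔ ¬ w ∈ ⊤ * oneLetter Sᶜ * ⊤ := Iff.rfl
  rw [h2, this]
  push Not
  rfl

theorem isStarFree_allLetters [Finite A] (S : Set A) : IsStarFree (allLetters S) :=
  .compl (.concat (.concat .top (isStarFree_oneLetter _)) .top)

/-- The words in which all pairs of adjacent letters satisfy `R`. -/
def chainLanguage (R : A → A → Prop) : Language A :=
  (⊤ * (⨆ q : {q : A × A // ¬ R q.1 q.2}, {[q.1.1]} * {[q.1.2]}) * ⊤)ᶜ

theorem mem_chainLanguage {R : A → A → Prop} {w : List A} :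
    w ∈ chainLanguage R ↔ w.IsChain R := by
  have h2 : w ∈ chainLanguage R ↔ ¬ w ∈ ⊤ * (⨆ q : {q : A × A // ¬ R q.1 q.2},
    ({[q.1.1]} * {[q.1.2]} : Language A)) * ⊤ := Iff.rfl
  rw [h2, mem_top_mul_mul_top]
  constructor
  · intro h
    rw [List.isChain_iff_getElem]
    intro i hi
    by_contra hR
    refine h ⟨w.take i, [w[i], w[i + 1]], w.drop (i + 2),
      Language.mem_iSup'.2 ⟨⟨(w[i], w[i + 1]), hR⟩, [w[i]], rfl, [w[i + 1]], rfl, rfl⟩, ?_⟩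
    rw [List.append_assoc]
    conv_lhs => rw [← List.take_append_drop i w]
    rw [List.drop_eq_getElem_cons (by omega), List.drop_eq_getElem_cons hi]
    rfl
  · rintro h ⟨u, v, x, hv, rfl⟩
    obtain ⟨⟨⟨a, b⟩, hR⟩, _, rfl, _, rfl, rfl⟩ := Language.mem_iSup'.1 hv
    have h1 := List.isChain_append.1 h
    have h3 := (List.isChain_append.1 h1.1).2.1
    exact hR (by simpa using h3)

theorem isStarFree_chainLanguage [Finite A] (R : A → A → Prop) :
    IsStarFree (chainLanguage R) :=
  .compl (.concat (.concat .top (.iSup fun _ => .concat (.letter _) (.letter _))) .top)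

end StarFree

/-! ### The concurrent alphabet and the star-free language of the reduction -/

section CheckLanguage

variable {α : ℕ}

/-- The thread of a letter: `Fin (4 * α)` consists of `α` threads with four letters each. -/
def thread (x : Fin (4 * α)) : ℕ := x / 4

/-- The symbol of a letter within its thread: `3` marks the beginning of a block, `2` the end of a
clause, `1` a literal that the block makes true, and `0` any other literal. -/
def symbol (x : Fin (4 * α)) : ℕ := x % 4

theorem thread_lt (x : Fin (4 * α)) : thread x < α := by
  have := x.isLt
  simp only [thread]
  omega

theorem symbol_lt (x : Fin (4 * α)) : symbol x < 4 := Nat.mod_lt _ (by norm_num)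

/-- Letters are independent when they are in different threads. -/
def threadGraph (α : ℕ) : SimpleGraph (Fin (4 * α)) := SimpleGraph.comap thread ⊤

theorem cliqueNum_threadGraph (α : ℕ) : (threadGraph α).cliqueNum = α := by
  apply le_antisymm
  · obtain ⟨s, hs⟩ := (threadGraph α).exists_isNClique_cliqueNum
    rw [← hs.card_eq]
    refine (Finset.card_le_card_of_injOn (t := Finset.range α) thread
      (fun x _ => by simpa using thread_lt x) ?_).trans_eq (Finset.card_range α)
    intro x hx y hy hxy
    by_contra hne
    exact hs.isClique hx hy hne hxy
  · let f : Fin α ↪ Fin (4 * α) :=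
      ⟨fun i => ⟨4 * i, by omega⟩, fun i j h => by simpa [Fin.ext_iff] using h⟩
    have hf : ∀ i, thread (f i) = i := fun i => Nat.mul_div_cancel_left _ (by norm_num)
    have hc : (threadGraph α).IsClique (Finset.univ.map f : Finset (Fin (4 * α))) := by
      intro x hx y hy hne
      simp only [Finset.coe_map, Set.mem_image, Finset.coe_univ, Set.mem_univ, true_and] at hx hy
      obtain ⟨i, rfl⟩ := hx
      obtain ⟨j, rfl⟩ := hy
      have : i ≠ j := fun h => hne (by rw [h])
      simpa [threadGraph, hf, Fin.ext_iff] using this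
    simpa using hc.card_le_cliqueNum

/-- Adjacent letters `x`, `y` of a lockstep run of all threads: the threads take turns, and the
threads begin a block in the same round. -/
def Lockstep (x y : Fin (4 * α)) : Prop :=
  thread y = (thread x + 1) % α ∧ (thread x + 1 < α → (symbol x = 3 ↔ symbol y = 3))

/-- The words with a factor that begins with the last letter of a separating round, ends with the
first letter of the round at the end of a clause, and in between shows no true literal. -/
def falseClause (α : ℕ) : Language (Fin (4 * α)) :=
  ⊤ * (oneLetter {x | thread x + 1 = α ∧ 2 ≤ symbol x} * allLetters {x | symbol x = 0} *
    oneLetter {x | thread x = 0 ∧ symbol x = 2}) * ⊤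

/-- The words with a factor that is a lockstep run of all threads, from the beginning of a block of
each thread to the beginning of another block, which shows that no clause is false. -/
def checkLanguage (α : ℕ) : Language (Fin (4 * α)) :=
  ⊤ * (oneLetter {x | thread x = 0 ∧ symbol x = 3} * ⊤ *
    oneLetter {x | thread x = 0 ∧ symbol x = 3} ⊓ chainLanguage Lockstep ⊓ (falseClause α)ᶜ) * ⊤

theorem isStarFree_checkLanguage (α : ℕ) : IsStarFree (checkLanguage α) :=
  .concat (.concat .top (.inter (.inter
    (.concat (.concat (isStarFree_oneLetter _) .top) (isStarFree_oneLetter _))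
    (isStarFree_chainLanguage _))
    (.compl (.concat (.concat .top (.concat (.concat (isStarFree_oneLetter _)
      (isStarFree_allLetters _)) (isStarFree_oneLetter _))) .top)))) .top

theorem mem_falseClause {w : List (Fin (4 * α))} : w ∈ falseClause α ↔
    ∃ (k₁ k₂ : ℕ) (h₁ : k₁ < k₂) (h₂ : k₂ < w.length),
      thread w[k₁] + 1 = α ∧ 2 ≤ symbol w[k₁] ∧ thread w[k₂] = 0 ∧ symbol w[k₂] = 2 ∧
      ∀ k (_ : k₁ < k) (_ : k < k₂), symbol w[k] = 0 := by
  rw [falseClause, mem_top_mul_mul_top]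
  constructor
  · rintro ⟨u, _, v, ⟨_, ⟨_, hs, f, hf, rfl⟩, _, ht, rfl⟩, rfl⟩
    obtain ⟨s, hs', rfl⟩ := mem_oneLetter.1 hs
    obtain ⟨t, ht', rfl⟩ := mem_oneLetter.1 ht
    have hf := mem_allLetters.1 hf
    have e₁ : (u ++ ([s] ++ f ++ [t]) ++ v)[u.length]'(by simp) = s := by
      simp
    have e₂ : (u ++ ([s] ++ f ++ [t]) ++ v)[u.length + 1 + f.length]'(by simp; omega) = t := by
      simp only [show u ++ ([s] ++ f ++ [t]) ++ v = (u ++ [s] ++ f) ++ (t :: v) by simp]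
      rw [List.getElem_append_right (by simp; omega)]
      simp [show u.length + 1 + f.length - (u.length + (f.length + 1)) = 0 by omega]
    refine ⟨u.length, u.length + 1 + f.length, by omega, by simp; omega, ?_⟩
    simp only [e₁, e₂]
    refine ⟨hs'.1, hs'.2, ht'.1, ht'.2, fun k hk hk' => hf _ ?_⟩
    simp only [show u ++ ([s] ++ f ++ [t]) ++ v = (u ++ [s]) ++ (f ++ (t :: v)) by simp]
    rw [List.getElem_append_right (by simp; omega), List.getElem_append_left (by simp; omega)]
    exact List.getElem_mem _
  · rintro ⟨k₁, k₂, h₁, h₂, t₁, s₁, t₂, s₂, h⟩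
    refine ⟨w.take k₁, _, w.drop (k₂ + 1), ⟨_, ⟨_, mem_oneLetter.2 ⟨w[k₁], ⟨t₁, s₁⟩, rfl⟩,
      (w.drop (k₁ + 1)).take (k₂ - (k₁ + 1)), ?_, rfl⟩, _,
      mem_oneLetter.2 ⟨w[k₂], ⟨t₂, s₂⟩, rfl⟩, rfl⟩, ?_⟩
    · refine mem_allLetters.2 fun a ha => ?_
      obtain ⟨i, hi, rfl⟩ := List.mem_iff_getElem.1 ha
      simp only [List.length_take, List.length_drop] at hi
      simp only [List.getElem_take, List.getElem_drop]
      exact h _ (by omega) (by omega)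
    · have e₁ : w = w.take k₁ ++ w[k₁] :: w.drop (k₁ + 1) := by simp
      have e₂ : w.drop (k₁ + 1) =
          (w.drop (k₁ + 1)).take (k₂ - (k₁ + 1)) ++ w[k₂] :: w.drop (k₂ + 1) := by
        conv_lhs => rw [← List.take_append_drop (k₂ - (k₁ + 1)) (w.drop (k₁ + 1))]
        rw [List.drop_drop, show k₁ + 1 + (k₂ - (k₁ + 1)) = k₂ by omega,
          List.drop_eq_getElem_cons h₂]
      conv_lhs => rw [e₁, e₂]
      simp

theorem mem_checkLanguage {w : List (Fin (4 * α))} : w ∈ checkLanguage α ↔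
    ∃ x y z : List (Fin (4 * α)), w = x ++ y ++ z ∧
      (∃ (L : ℕ) (_ : 0 < L) (hL : y.length = L + 1),
        (thread y[0] = 0 ∧ symbol y[0] = 3) ∧ (thread y[L] = 0 ∧ symbol y[L] = 3)) ∧
      (∀ k (hk : k + 1 < y.length), Lockstep y[k] y[k + 1]) ∧ y ∉ falseClause α := by
  rw [checkLanguage, mem_top_mul_mul_top]
  constructor
  · rintro ⟨x, y, z, ⟨⟨hy, hc⟩, hf⟩, rfl⟩
    refine ⟨x, y, z, rfl, ?_, List.isChain_iff_getElem.1 (mem_chainLanguage.1 hc), hf⟩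
    obtain ⟨_, ⟨_, h₁, v, -, rfl⟩, _, h₂, rfl⟩ := hy
    obtain ⟨a, ha, rfl⟩ := mem_oneLetter.1 h₁
    obtain ⟨b, hb, rfl⟩ := mem_oneLetter.1 h₂
    refine ⟨v.length + 1, by omega, by simp, ?_, ?_⟩
    · simpa using ha
    · simpa using hb
  · rintro ⟨x, y, z, rfl, ⟨L, hL0, hL, h₁, h₂⟩, hc, hf⟩
    refine ⟨x, y, z, ⟨⟨⟨_, ⟨_, mem_oneLetter.2 ⟨y[0], h₁, rfl⟩, (y.drop 1).take (L - 1), trivial,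
      rfl⟩, _, mem_oneLetter.2 ⟨y[L], h₂, rfl⟩, ?_⟩,
      mem_chainLanguage.2 (List.isChain_iff_getElem.2 hc)⟩, hf⟩, rfl⟩
    have e₃ : y.drop L = [y[L]] := by
      rw [List.drop_eq_getElem_cons (by omega), List.drop_eq_nil_of_le (by omega)]
    have e₂ : (y.drop 1).take (L - 1) ++ [y[L]] = y.drop 1 := by
      rw [← e₃]
      conv_rhs => rw [← List.take_append_drop (L - 1) (y.drop 1)]
      rw [List.drop_drop, show 1 + (L - 1) = L by omega]
    change [y[0]] ++ (y.drop 1).take (L - 1) ++ [y[L]] = y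
    rw [List.append_assoc, e₂]
    exact (List.drop_eq_getElem_cons (i := 0) (by omega)).symm

/-! ### Lockstep runs and their projections -/

theorem filter_thread_range {g : ℕ → Fin (4 * α)} {n i : ℕ} (hg : ∀ j < n, thread (g j) = j) :
    ((List.range n).map g).filter (thread · = i) = if i < n then [g i] else [] := by
  induction n with
  | zero => simp
  | succ n ih =>
    rw [List.range_succ, List.map_append, List.filter_append, ih fun j hj => hg j (by omega)]
    have hn := hg n (by omega)
    rcases lt_trichotomy i n with h | h | h
    · simp [hn, h, h.ne', h.trans (Nat.lt_succ_self n)]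
    · subst h; simp [hn]
    · simp [hn, h.ne, h.not_gt, show ¬ i < n + 1 by omega]

/-- The projection to thread `i` of a word in which the threads take turns. -/
theorem filter_thread_rounds {g : ℕ → Fin (4 * α)} {R i : ℕ} (hi : i < α)
    (hg : ∀ k < R * α, thread (g k) = k % α) :
    ((List.range (R * α)).map g).filter (thread · = i) =
      (List.range R).map fun r => g (r * α + i) := by
  induction R with
  | zero => simp
  | succ R ih =>
    rw [Nat.succ_mul R α, List.range_add, List.map_append, List.filter_append,
      ih fun k hk => hg k (by rw [Nat.succ_mul R α]; omega), List.map_map,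
      filter_thread_range (n := α), if_pos hi, List.range_succ, List.map_append]
    · rfl
    · intro j hj
      rw [Function.comp_apply, hg _ (by rw [Nat.succ_mul R α]; omega), Nat.mul_add_mod_self_right,
        Nat.mod_eq_of_lt hj]

theorem filter_thread_flatMap {u : ℕ → List (Fin (4 * α))} {n i : ℕ}
    (hu : ∀ j < n, ∀ x ∈ u j, thread x = j) :
    ((List.range n).flatMap u).filter (thread · = i) = if i < n then u i else [] := by
  induction n with
  | zero => simp
  | succ n ih =>
    rw [List.range_succ, List.flatMap_append, List.filter_append,
      ih fun j hj => hu j (by omega)]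
    have hn := hu n (by omega)
    have : ((List.flatMap u [n]).filter (thread · = i)) = if i = n then u n else [] := by
      rw [List.flatMap_singleton]
      split_ifs with h
      · exact List.filter_eq_self.2 fun x hx => by simp [hn x hx, h]
      · exact List.filter_eq_nil_iff.2 fun x hx => by simpa [hn x hx] using Ne.symm h
    rw [this]
    rcases lt_trichotomy i n with h | h | h
    · simp [h, h.ne, h.trans (Nat.lt_succ_self n)]
    · subst h; simp
    · simp [h.ne', h.not_gt, show ¬ i < n + 1 by omega]

/-! ### Soundness and completeness of the reduction -/

/-- Every clause is true: between a separating position `p` of a sequence `e` of `ℓ` cells and the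
next cell `0` there is a position at which one of the `α` threads shows a true literal. -/
def EveryClauseTrue (α ℓ : ℕ) (e : ℕ → ℕ) (lit : ℕ → ℕ → Prop) : Prop :=
  ∀ p r, p < r → r < ℓ → (p = 0 ∨ e p = 0) → e r = 0 → (∀ k, p < k → k < r → e k ≠ 0) →
    ∃ k, p < k ∧ k < r ∧ ∃ i < α, lit i k

/-- The word `w` consists of one block of `ℓ` letters for each thread `i < α` and each number
`a < A`. The letter of position `j` of this block has the symbol `3` if `j = 0`, otherwise `2` if
the cell `e j` is `0`, and otherwise `1` or `0` according to `lit i a j`. The letter number `r` of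
thread `i` is `ltr i r`. -/
structure IsBlockWord (ℓ A : ℕ) (e : ℕ → ℕ) (lit : ℕ → ℕ → ℕ → Prop)
    (ltr : ℕ → ℕ → Fin (4 * α)) (w : List (Fin (4 * α))) : Prop where
  thread_ltr : ∀ i < α, ∀ r < ℓ * A, thread (ltr i r) = i
  three : ∀ i < α, ∀ r < ℓ * A, symbol (ltr i r) = 3 ↔ r % ℓ = 0
  two : ∀ i < α, ∀ r < ℓ * A, symbol (ltr i r) = 2 ↔ r % ℓ ≠ 0 ∧ e (r % ℓ) = 0
  one : ∀ i < α, ∀ r < ℓ * A, symbol (ltr i r) = 1 ↔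
    r % ℓ ≠ 0 ∧ e (r % ℓ) ≠ 0 ∧ lit i (r / ℓ) (r % ℓ)
  filter_eq : ∀ i < α, w.filter (thread · = i) = (List.range (ℓ * A)).map (ltr i)

theorem filter_thread_of_le {i : ℕ} (hi : α ≤ i) (w : List (Fin (4 * α))) :
    w.filter (thread · = i) = [] := by
  refine List.filter_eq_nil_iff.2 fun x _ => ?_
  have := thread_lt x
  simp
  omega

/-- Soundness of the reduction. In a lockstep factor `y` of a word equivalent to a block word, round
`r` consists of letters of all threads, and these are consecutive letters of the threads when `r`
varies. As all threads begin a block in round `0`, and as thread `0` begins another block at the end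
of `y`, the first `ℓ` rounds consist of exactly one block of each thread. -/
theorem IsBlockWord.exists_of_mem {ℓ A : ℕ} {e : ℕ → ℕ} {lit : ℕ → ℕ → ℕ → Prop}
    {ltr : ℕ → ℕ → Fin (4 * α)} {w : List (Fin (4 * α))} (hα : 0 < α) (hℓ : 0 < ℓ)
    (hw : IsBlockWord ℓ A e lit ltr w)
    (h : w ∈ PredictiveMonitoring (threadGraph α) (checkLanguage α)) :
    ∃ a : ℕ → ℕ, EveryClauseTrue α ℓ e fun i k => lit i (a i) k := by
  obtain ⟨w', hww', hw'⟩ := h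
  rw [threadGraph, traceEquiv_comap_top_iff] at hww'
  obtain ⟨x, y, z, rfl, ⟨L, hL0, hL, ⟨t0, s0⟩, tL, sL⟩, hc, hf⟩ := mem_checkLanguage.1 hw'
  have hth : ∀ k (hk : k < y.length), thread y[k] = k % α := by
    intro k
    induction k with
    | zero => intro _; simpa using t0
    | succ k ih =>
      intro hk
      rw [(hc k hk).1, ih (by omega), Nat.mod_add_mod]
  -- the run consists of `R` complete rounds and one letter of thread `0`
  obtain ⟨R, rfl⟩ : ∃ R, L = R * α := by
    have : L % α = 0 := by rw [← hth L (by omega), tL]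
    exact ⟨L / α, by rw [Nat.div_mul_cancel (Nat.dvd_of_mod_eq_zero this)]⟩
  have hR : 0 < R := Nat.pos_of_mul_pos_right hL0
  have hidx : ∀ {r i}, r < R → i < α → r * α + i < y.length := by
    intro r i hr hi
    have : (r + 1) * α ≤ R * α := Nat.mul_le_mul_right _ hr
    rw [Nat.add_mul] at this
    omega
  have hmod : ∀ {r i}, i < α → (r * α + i) % α = i := by
    intro r i hi
    rw [Nat.mul_add_mod_self_right, Nat.mod_eq_of_lt hi]
  -- the number of letters of thread `i` before the lockstep factor
  let o : ℕ → ℕ := fun i => (x.filter (thread · = i)).length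
  have hproj : ∀ i < α, x.filter (thread · = i) ++ y.filter (thread · = i) ++
      z.filter (thread · = i) = (List.range (ℓ * A)).map (ltr i) := by
    intro i hi
    rw [← hw.filter_eq i hi, hww' i, List.filter_append, List.filter_append]
  have hy : y = (List.range (R * α)).map (fun k => y.getD k y[0]) ++ [y[R * α]] := by
    apply List.ext_getElem
    · simp [hL]
    · intro k h1 h2
      rw [List.getElem_append]
      split_ifs with h
      · simp [List.getElem?_eq_getElem h1]
      · obtain rfl : k = R * α := by simp at h; omega
        simp
  have hyf : ∀ i < α, y.filter (thread · = i) =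
      (List.range R).map (fun r => y.getD (r * α + i) y[0]) ++
        [y[R * α]].filter (thread · = i) := by
    intro i hi
    conv_lhs => rw [hy]
    rw [List.filter_append, filter_thread_rounds hi]
    intro k hk
    rw [List.getD_eq_getElem _ _ (by omega), hth]
  have hget : ∀ r < R, ∀ i < α, ∀ (hk : r * α + i < y.length),
      o i + r < ℓ * A ∧ ltr i (o i + r) = y[r * α + i] := by
    intro r hr i hi hk
    have h1 := congrArg (fun l => l[o i + r]?) (hproj i hi)
    simp only [hyf i hi] at h1
    rw [List.append_assoc, List.getElem?_append_right (by simp [o]), List.append_assoc,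
      List.getElem?_append_left (by simp [o]; omega)] at h1
    simp only [o, Nat.add_sub_cancel_left, List.getElem?_map, List.getElem?_range hr,
      Option.map_some, List.getD_eq_getElem _ _ hk] at h1
    have h2 := h1.symm
    rw [Option.map_eq_some_iff] at h2
    obtain ⟨q, hq, hq'⟩ := h2
    obtain ⟨hlt, hval⟩ := List.getElem?_eq_some_iff.1 hq
    simp only [List.length_range] at hlt
    simp only [List.getElem_range] at hval
    subst hval
    exact ⟨hlt, hq'⟩
  have hgetL : o 0 + R < ℓ * A ∧ ltr 0 (o 0 + R) = y[R * α] := by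
    have h1 := congrArg (fun l => l[o 0 + R]?) (hproj 0 hα)
    simp only [hyf 0 hα] at h1
    rw [List.append_assoc, List.getElem?_append_right (by simp [o]), List.append_assoc,
      List.getElem?_append_right (by simp [o]), List.filter_cons_of_pos (by simpa using tL)] at h1
    simp only [o, List.length_map, List.length_range, Nat.add_sub_cancel_left, Nat.sub_self,
      List.getElem?_map] at h1
    have h2 := h1.symm
    simp only [List.filter_nil, List.cons_append, List.getElem?_cons_zero] at h2
    rw [Option.map_eq_some_iff] at h2
    obtain ⟨q, hq, hq'⟩ := h2
    obtain ⟨hlt, hval⟩ := List.getElem?_eq_some_iff.1 hq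
    simp only [List.length_range] at hlt
    simp only [List.getElem_range] at hval
    subst hval
    exact ⟨hlt, hq'⟩
  have hs0 : ∀ i (hi : i < α) (hk : i < y.length), symbol y[i] = 3 := by
    intro i
    induction i with
    | zero => intro _ _; exact s0
    | succ i ih =>
      intro hi hk
      refine ((hc i hk).2 ?_).1 (ih (by omega) (by omega))
      rw [hth, Nat.mod_eq_of_lt (by omega)]
      exact hi
  have hdvd : ∀ i < α, ℓ ∣ o i := by
    intro i hi
    have hk : 0 * α + i < y.length := hidx hR hi
    obtain ⟨h1, h2⟩ := hget 0 hR i hi hk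
    refine Nat.dvd_of_mod_eq_zero ((hw.three i hi (o i) h1).1 ?_)
    have h3 := hs0 i hi (by omega)
    rw [Nat.add_zero] at h2
    rw [h2]
    simpa using h3
  have hℓR : ℓ ≤ R := by
    refine Nat.le_of_dvd hR ((Nat.dvd_add_right (hdvd 0 hα)).1
      (Nat.dvd_of_mod_eq_zero ((hw.three 0 hα _ hgetL.1).1 ?_)))
    rw [hgetL.2, sL]
  have hmodℓ : ∀ i < α, ∀ r < ℓ, (o i + r) % ℓ = r ∧ (o i + r) / ℓ = o i / ℓ := by
    intro i hi r hr
    obtain ⟨b, hb⟩ := hdvd i hi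
    rw [hb, Nat.mul_add_mod, Nat.mod_eq_of_lt hr, Nat.mul_add_div hℓ, Nat.div_eq_of_lt hr,
      Nat.mul_div_cancel_left _ hℓ]
    exact ⟨rfl, rfl⟩
  refine ⟨fun i => o i / ℓ, fun p r hpr hr hp her hne => ?_⟩
  by_contra hcon
  push Not at hcon
  apply hf
  rw [mem_falseClause]
  have hα1 : α - 1 < α := by omega
  have h₁ : p * α + (α - 1) < r * α + 0 := by
    have : (p + 1) * α ≤ r * α := Nat.mul_le_mul_right _ hpr
    rw [Nat.add_mul] at this
    omega
  have h₂ : r * α + 0 < y.length := hidx (by omega) hα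
  obtain ⟨b₁, g₁⟩ := hget p (by omega) (α - 1) hα1 (h₁.trans h₂)
  obtain ⟨b₂, g₂⟩ := hget r (by omega) 0 hα h₂
  refine ⟨p * α + (α - 1), r * α + 0, h₁, h₂, ?_, ?_, ?_, ?_, fun k hk hk' => ?_⟩
  · rw [hth, hmod hα1]; omega
  · rw [← g₁]
    by_cases h0 : p = 0
    · rw [(hw.three (α - 1) hα1 _ b₁).2]
      · norm_num
      · rw [(hmodℓ _ hα1 p (by omega)).1, h0]
    · rw [(hw.two (α - 1) hα1 _ b₁).2]
      rw [(hmodℓ _ hα1 p (by omega)).1]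
      exact ⟨h0, hp.resolve_left h0⟩
  · rw [hth, hmod hα]
  · rw [← g₂, (hw.two 0 hα _ b₂).2]
    rw [(hmodℓ _ hα r hr).1]
    exact ⟨by omega, her⟩
  · have hkα : k / α * α + k % α = k := Nat.div_add_mod' k α
    have hkm : k % α < α := Nat.mod_lt _ hα
    have hpk : p < k / α := by
      rw [← Nat.succ_le_iff, Nat.le_div_iff_mul_le hα, Nat.succ_mul p α]
      omega
    have hkr : k / α < r := by
      rw [Nat.div_lt_iff_lt_mul hα]
      omega
    obtain ⟨b, g⟩ := hget (k / α) (by omega) (k % α) hkm (by omega)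
    have hsym : symbol (ltr (k % α) (o (k % α) + k / α)) = 0 := by
      have m := hmodℓ (k % α) hkm (k / α) (by omega)
      have n1 := mt (hw.one _ hkm _ b).1 (by
        rw [m.1, m.2]
        exact fun h => hcon _ hpk hkr _ hkm h.2.2)
      have n2 := mt (hw.two _ hkm _ b).1 (by
        rw [m.1]
        exact fun h => hne _ hpk hkr h.2)
      have n3 := mt (hw.three _ hkm _ b).1 (by
        rw [m.1]
        omega)
      have := symbol_lt (ltr (k % α) (o (k % α) + k / α))
      omega
    rw [g] at hsym
    simpa only [hkα] using hsym

theorem map_range_eq_take_drop {β : Type*} {f : ℕ → β} {s c n : ℕ} (h : s + c ≤ n) :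
    (List.range c).map (fun r => f (s + r)) = (((List.range n).map f).drop s).take c := by
  apply List.ext_getElem
  · simp; omega
  · intro k h1 h2
    simp

/-- Completeness of the reduction. Given one block of each thread such that every clause is true, a
word of the language is obtained by running what precedes these blocks, then the blocks in lockstep,
then what follows. The lockstep run ends with the first letter of the next block of thread `0`, so
the given block must not be the last one. -/
theorem IsBlockWord.mem_predictiveMonitoring {ℓ A : ℕ} {e : ℕ → ℕ} {lit : ℕ → ℕ → ℕ → Prop}
    {ltr : ℕ → ℕ → Fin (4 * α)} {w : List (Fin (4 * α))} (hα : 0 < α) (hℓ : 0 < ℓ)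
    (hw : IsBlockWord ℓ A e lit ltr w) {a : ℕ → ℕ} (ha : ∀ i < α, a i + 1 < A)
    (h : EveryClauseTrue α ℓ e fun i k => lit i (a i) k) :
    w ∈ PredictiveMonitoring (threadGraph α) (checkLanguage α) := by
  have hlt : ∀ i < α, ∀ r ≤ ℓ, a i * ℓ + r < ℓ * A := by
    intro i hi r hr
    have h1 : (a i + 1 + 1) * ℓ ≤ A * ℓ := Nat.mul_le_mul_right _ (ha i hi)
    rw [Nat.add_mul, Nat.add_mul, Nat.mul_comm A] at h1
    omega
  have hmod : ∀ i, ∀ r < ℓ, (a i * ℓ + r) % ℓ = r ∧ (a i * ℓ + r) / ℓ = a i := by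
    intro i r hr
    rw [Nat.mul_add_mod_self_right, Nat.mod_eq_of_lt hr, Nat.mul_comm, Nat.mul_add_div hℓ,
      Nat.div_eq_of_lt hr]
    exact ⟨rfl, rfl⟩
  let g : ℕ → Fin (4 * α) := fun k => ltr (k % α) (a (k % α) * ℓ + k / α)
  have hdiv : ∀ k < ℓ * α + 1, k / α ≤ ℓ := by
    intro k hk
    rw [← Nat.lt_succ_iff, Nat.div_lt_iff_lt_mul hα, Nat.succ_mul]
    omega
  have hb : ∀ k < ℓ * α + 1, a (k % α) * ℓ + k / α < ℓ * A := fun k hk =>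
    hlt _ (Nat.mod_lt _ hα) _ (hdiv k hk)
  have hgth : ∀ k < ℓ * α + 1, thread (g k) = k % α := fun k hk =>
    hw.thread_ltr _ (Nat.mod_lt _ hα) _ (hb k hk)
  have hg3 : ∀ k < ℓ * α + 1, (symbol (g k) = 3 ↔ k / α % ℓ = 0) := fun k hk => by
    rw [hw.three _ (Nat.mod_lt _ hα) _ (hb k hk), Nat.mul_add_mod_self_right]
  have hg2 : ∀ k < ℓ * α + 1,
      (symbol (g k) = 2 ↔ k / α % ℓ ≠ 0 ∧ e (k / α % ℓ) = 0) := fun k hk => by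
    rw [hw.two _ (Nat.mod_lt _ hα) _ (hb k hk), Nat.mul_add_mod_self_right]
  -- the number of letters of thread `i` in the lockstep run
  let c : ℕ → ℕ := fun i => ℓ + if i = 0 then 1 else 0
  -- the projection of the block word to thread `i`
  let all : ℕ → List (Fin (4 * α)) := fun i => (List.range (ℓ * A)).map (ltr i)
  have hall : ∀ i < α, ∀ x ∈ all i, thread x = i := by
    intro i hi x hx
    obtain ⟨r, hr, rfl⟩ := List.mem_map.1 hx
    exact hw.thread_ltr i hi r (List.mem_range.1 hr)
  let x := (List.range α).flatMap fun i => (all i).take (a i * ℓ)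
  let y := (List.range (ℓ * α + 1)).map g
  let z := (List.range α).flatMap fun i => (all i).drop (a i * ℓ + c i)
  have hylen : y.length = ℓ * α + 1 := by simp [y]
  have hyget : ∀ k (hk : k < y.length), y[k] = g k := fun k hk => by simp [y]
  have hyf : ∀ i < α, y.filter (thread · = i) = ((all i).drop (a i * ℓ)).take (c i) := by
    intro i hi
    simp only [y]
    rw [List.range_succ, List.map_append, List.filter_append,
      filter_thread_rounds hi fun k hk => hgth k (by omega),
      ← map_range_eq_take_drop (f := ltr i)
        (by have := hlt i hi ℓ le_rfl; simp only [c]; split_ifs <;> omega)]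
    have e₁ : ∀ r, g (r * α + i) = ltr i (a i * ℓ + r) := by
      intro r
      simp only [g]
      rw [Nat.mul_add_mod_self_right, Nat.mod_eq_of_lt hi, Nat.mul_comm r, Nat.mul_add_div hα,
        Nat.div_eq_of_lt hi, Nat.add_zero]
    simp only [e₁, c]
    by_cases h0 : i = 0
    · subst h0
      have := e₁ ℓ
      rw [Nat.add_zero] at this
      simp [List.range_succ, this, hw.thread_ltr 0 hα _ (hlt 0 hα ℓ le_rfl)]
    · have := hgth (ℓ * α) (by omega)
      rw [Nat.mul_mod_left] at this
      simp [h0, this, Ne.symm h0]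
  refine ⟨x ++ y ++ z, ?_, mem_checkLanguage.2 ⟨x, y, z, rfl, ⟨ℓ * α, Nat.mul_pos hℓ hα, hylen,
    ?_, ?_⟩, ?_, ?_⟩⟩
  · rw [threadGraph, traceEquiv_comap_top_iff]
    intro i
    rcases Nat.lt_or_ge i α with hi | hi
    · rw [hw.filter_eq i hi, List.filter_append, List.filter_append, hyf i hi,
        filter_thread_flatMap fun j hj u hu => hall j hj u (List.mem_of_mem_take hu),
        filter_thread_flatMap fun j hj u hu => hall j hj u (List.mem_of_mem_drop hu),
        if_pos hi, if_pos hi, List.append_assoc, ← List.drop_drop, List.take_append_drop,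
        List.take_append_drop]
    · rw [filter_thread_of_le hi, filter_thread_of_le hi]
  · rw [hyget, hgth 0 (by omega), hg3 0 (by omega)]
    simp
  · rw [hyget, hgth _ (by omega), hg3 _ (by omega)]
    simp [Nat.mul_div_cancel _ hα]
  · intro k hk
    rw [hyget, hyget]
    refine ⟨by rw [hgth _ (by omega), hgth _ (by omega), Nat.mod_add_mod], fun hkα => ?_⟩
    rw [hgth _ (by omega)] at hkα
    rw [hg3 _ (by omega), hg3 _ (by omega)]
    have : (k + 1) / α = k / α := by
      rw [Nat.succ_div_of_not_dvd]
      intro hd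
      have h1 := Nat.mod_eq_zero_of_dvd hd
      rw [← Nat.mod_add_mod, Nat.mod_eq_of_lt hkα] at h1
      omega
    rw [this]
  · rw [mem_falseClause]
    rintro ⟨k₁, k₂, h₁, h₂, t₁, s₁, t₂, s₂, hf⟩
    rw [hyget] at t₁ s₁ t₂ s₂
    rw [hylen] at h₂
    rw [hgth _ (by omega)] at t₁ t₂
    have d₁ := Nat.div_add_mod' k₁ α
    have d₂ := Nat.div_add_mod' k₂ α
    have hr : k₂ / α < ℓ := by
      refine lt_of_le_of_ne (hdiv k₂ h₂) fun hr => ?_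
      have := (hg2 k₂ h₂).1 s₂
      rw [hr, Nat.mod_self] at this
      exact this.1 rfl
    have hpr : k₁ / α < k₂ / α := by
      rw [Nat.div_lt_iff_lt_mul hα]
      omega
    have m₁ : k₁ / α % ℓ = k₁ / α := Nat.mod_eq_of_lt (by omega)
    have m₂ : k₂ / α % ℓ = k₂ / α := Nat.mod_eq_of_lt hr
    have hbetween : ∀ k, k₁ / α < k → k < k₂ / α → ∀ i < α,
        symbol (ltr i (a i * ℓ + k)) = 0 := by
      intro k hk hk' i hi
      have l₁ : (k₁ / α + 1) * α ≤ k * α := Nat.mul_le_mul_right _ hk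
      have l₂ : (k + 1) * α ≤ k₂ / α * α := Nat.mul_le_mul_right _ hk'
      rw [Nat.add_mul] at l₁ l₂
      have := hf (k * α + i) (by omega) (by omega)
      rw [hyget] at this
      simp only [g] at this
      rwa [Nat.mul_add_mod_self_right, Nat.mod_eq_of_lt hi, Nat.mul_comm k, Nat.mul_add_div hα,
        Nat.div_eq_of_lt hi, Nat.add_zero] at this
    have hne : ∀ k, k₁ / α < k → k < k₂ / α → e k ≠ 0 := by
      intro k hk hk' hek
      have h0 := hbetween k hk hk' 0 hα
      have h2 := (hw.two 0 hα _ (hlt 0 hα k (by omega))).2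
      rw [(hmod 0 k (by omega)).1] at h2
      have := h2 ⟨by omega, hek⟩
      omega
    have hp : k₁ / α = 0 ∨ e (k₁ / α) = 0 := by
      have h4 := symbol_lt (g k₁)
      have h5 : symbol (g k₁) = 2 ∨ symbol (g k₁) = 3 := by omega
      rcases h5 with h5 | h5
      · have := (hg2 k₁ (by omega)).1 h5
        rw [m₁] at this
        exact .inr this.2
      · have := (hg3 k₁ (by omega)).1 h5
        rw [m₁] at this
        exact .inl this
    have her : e (k₂ / α) = 0 := by
      have := (hg2 k₂ h₂).1 s₂
      rw [m₂] at this
      exact this.2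
    obtain ⟨k, hk, hk', i, hi, hlit⟩ := h (k₁ / α) (k₂ / α) hpr hr hp her hne
    have h0 := hbetween k hk hk' i hi
    have h1 := (hw.one i hi _ (hlt i hi k (by omega))).2
    rw [(hmod i k (by omega)).1, (hmod i k (by omega)).2] at h1
    have := h1 ⟨by omega, hne k hk hk', hlit⟩
    omega

end CheckLanguage

/-! ### Satisfiability in terms of the encoding -/

/-- The case of a sequence of cells that begins with a separator and `d` literals, followed by the
separating cell `0`. -/
theorem everyClauseTrue_shift {α d ℓ : ℕ} {e e' : ℕ → ℕ} {lit : ℕ → ℕ → Prop}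
    (he : ∀ k, e (d + 1 + k) = e' k) (he' : e' 0 = 0) (hd : ∀ k, 0 < k → k ≤ d → e k ≠ 0)
    (hℓ : 0 < ℓ) :
    EveryClauseTrue α (d + 1 + ℓ) e (fun i k => lit i (e k)) ↔
      (∃ k, 0 < k ∧ k ≤ d ∧ ∃ i < α, lit i (e k)) ∧
        EveryClauseTrue α ℓ e' (fun i k => lit i (e' k)) := by
  have he0 : e (d + 1) = 0 := by rw [← he', ← he 0]
  constructor
  · intro h
    constructor
    · obtain ⟨k, h1, h2, h3⟩ := h 0 (d + 1) (by omega) (by omega) (.inl rfl) he0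
        fun k hk hk' => hd k hk (by omega)
      exact ⟨k, h1, by omega, h3⟩
    · intro p r hpr hr hp her hne
      have hp' : e (d + 1 + p) = 0 := by
        rw [he]
        rcases hp with rfl | hp
        · exact he'
        · exact hp
      have hne' : ∀ k, d + 1 + p < k → k < d + 1 + r → e k ≠ 0 := by
        intro k hk hk'
        obtain ⟨k, rfl⟩ := Nat.exists_eq_add_of_le (show d + 1 ≤ k by omega)
        rw [he]
        exact hne k (by omega) (by omega)
      obtain ⟨k, h1, h2, h3⟩ := h (d + 1 + p) (d + 1 + r) (by omega) (by omega) (.inr hp')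
        (by rw [he, her]) hne'
      obtain ⟨k, rfl⟩ := Nat.exists_eq_add_of_le (show d + 1 ≤ k by omega)
      simp only [he] at h3
      exact ⟨k, by omega, by omega, h3⟩
  · rintro ⟨⟨k, h1, h2, h3⟩, h⟩ p r hpr hr hp her hne
    rcases Nat.lt_or_ge p (d + 1) with hpd | hpd
    · have hp0 : p = 0 := by
        by_contra h0
        exact hd p (by omega) (by omega) (hp.resolve_left h0)
      subst hp0
      have hrd : r = d + 1 := by
        by_contra h0
        rcases Nat.lt_or_ge r (d + 1) with h | h
        · exact hd r hpr (by omega) her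
        · exact hne (d + 1) (by omega) (by omega) he0
      exact ⟨k, h1, by omega, h3⟩
    · obtain ⟨p, rfl⟩ := Nat.exists_eq_add_of_le hpd
      obtain ⟨r, rfl⟩ := Nat.exists_eq_add_of_le (show d + 1 ≤ r by omega)
      obtain ⟨k, h1, h2, h3⟩ := h p r (by omega) (by omega)
        (.inr (by rw [← he]; exact hp.resolve_left (by omega))) (by rw [← he, her])
        fun k hk hk' => by rw [← he]; exact hne _ (by omega) (by omega)
      simp only [← he] at h3
      exact ⟨d + 1 + k, by omega, by omega, h3⟩

/-- The code of a literal in `KCNF.encode`. -/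
def literalCode {N : ℕ} (l : Fin N × Bool) : ℕ := 2 * (l.1 : ℕ) + l.2.toNat + 1

theorem everyClauseTrue_clauses {N α : ℕ} (lit : ℕ → ℕ → Prop)
    (Cs : List (List (Fin N × Bool))) (s : ℕ) :
    EveryClauseTrue α (s :: Cs.flatMap fun C => C.map literalCode ++ [0]).length
        (fun k => (s :: Cs.flatMap fun C => C.map literalCode ++ [0]).getD k 0)
        (fun i k => lit i ((s :: Cs.flatMap fun C => C.map literalCode ++ [0]).getD k 0)) ↔
      ∀ C ∈ Cs, ∃ l ∈ C, ∃ i < α, lit i (literalCode l) := by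
  induction Cs generalizing s with
  | nil =>
    simp only [List.not_mem_nil, false_imp_iff, implies_true, iff_true]
    intro p r hpr hr
    simp at hr
    omega
  | cons C Cs ih =>
    set t := Cs.flatMap fun C => C.map literalCode ++ [0] with ht
    have e₁ : s :: ((C :: Cs).flatMap fun C => C.map literalCode ++ [0]) =
        (s :: C.map literalCode) ++ (0 :: t) := by simp [ht]
    have hget : ∀ k (hk : k < C.length),
        ((s :: C.map literalCode) ++ (0 :: t)).getD (k + 1) 0 = literalCode C[k] := by
      intro k hk
      rw [List.getD_append _ _ _ _ (by simpa using hk)]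
      simp [hk]
    rw [e₁, show ((s :: C.map literalCode) ++ (0 :: t)).length = C.length + 1 + (0 :: t).length by
      simp; omega, everyClauseTrue_shift (lit := lit) (d := C.length)
        (e := fun k => ((s :: C.map literalCode) ++ (0 :: t)).getD k 0)
        (e' := fun k => (0 :: t).getD k 0) ?_ rfl ?_ (by simp), ih 0, List.forall_mem_cons]
    · refine and_congr_left fun _ => ⟨?_, ?_⟩
      · rintro ⟨k, h1, h2, h3⟩
        obtain ⟨k, rfl⟩ := Nat.exists_eq_succ_of_ne_zero h1.ne'
        rw [hget k h2] at h3
        exact ⟨_, List.getElem_mem _, h3⟩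
      · rintro ⟨l, hl, h3⟩
        obtain ⟨k, hk, rfl⟩ := List.mem_iff_getElem.1 hl
        exact ⟨k + 1, by omega, hk, by rw [hget k hk]; exact h3⟩
    · intro k
      rw [List.getD_append_right _ _ _ _ (by simp)]
      congr 1
      simp
    · intro k h1 h2
      obtain ⟨k, rfl⟩ := Nat.exists_eq_succ_of_ne_zero h1.ne'
      simp only [Nat.succ_eq_add_one]
      rw [hget k h2]
      simp [literalCode]

/-- The literal with code `c` is true under the assignment to the variables
`i * h, i * h + 1, …, i * h + h - 1` that is given by the binary digits of `a`. In particular,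
its variable is one of these. -/
def LiteralTrue (h i a c : ℕ) : Prop :=
  (c - 1) / 2 / h = i ∧ a / 2 ^ ((c - 1) / 2 % h) % 2 = (c - 1) % 2

theorem literalTrue_literalCode {N h i a : ℕ} (l : Fin N × Bool) :
    LiteralTrue h i a (literalCode l) ↔
      (l.1 : ℕ) / h = i ∧ a / 2 ^ ((l.1 : ℕ) % h) % 2 = l.2.toNat := by
  have hb : l.2.toNat < 2 := Bool.toNat_lt _
  rw [LiteralTrue, show (literalCode l - 1) / 2 = l.1 by simp only [literalCode]; omega,
    show (literalCode l - 1) % 2 = l.2.toNat by simp only [literalCode]; omega]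

/-- The cell number `j` of the encoding of a formula. -/
def KCNF.cell {k : ℕ} (φ : KCNF k) (j : ℕ) : ℕ := φ.encode.getD j 0

theorem KCNF.everyClauseTrue_iff {k : ℕ} (φ : KCNF k) {α h : ℕ} (a : ℕ → ℕ) :
    EveryClauseTrue α φ.encode.length φ.cell (fun i j => LiteralTrue h i (a i) (φ.cell j)) ↔
      ∀ C ∈ φ.clauses, ∃ l ∈ C, ∃ i < α, LiteralTrue h i (a i) (literalCode l) :=
  everyClauseTrue_clauses (fun i c => LiteralTrue h i (a i) c) φ.clauses φ.numVars

theorem KCNF.satisfiable_of_everyClauseTrue {k : ℕ} {φ : KCNF k} {α h : ℕ} {a : ℕ → ℕ}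
    (H : EveryClauseTrue α φ.encode.length φ.cell
      fun i j => LiteralTrue h i (a i) (φ.cell j)) : φ.Satisfiable := by
  refine ⟨fun v => decide (a ((v : ℕ) / h) / 2 ^ ((v : ℕ) % h) % 2 = 1), fun C hC => ?_⟩
  obtain ⟨l, hl, i, -, ht⟩ := (φ.everyClauseTrue_iff a).1 H C hC
  obtain ⟨h1, h2⟩ := (literalTrue_literalCode l).1 ht
  refine ⟨l, hl, ?_⟩
  simp only [h1, h2]
  cases l.2 <;> simp

theorem KCNF.Satisfiable.exists_everyClauseTrue {k : ℕ} {φ : KCNF k} (hφ : φ.Satisfiable)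
    {α h : ℕ} (hh : 0 < h) (hN : φ.numVars ≤ α * h) :
    ∃ a : ℕ → ℕ, (∀ i, a i < 2 ^ h) ∧ EveryClauseTrue α φ.encode.length φ.cell
      fun i j => LiteralTrue h i (a i) (φ.cell j) := by
  obtain ⟨b, hb⟩ := hφ
  let f : ℕ → ℕ → Bool := fun i r => if hv : i * h + r < φ.numVars then b ⟨_, hv⟩ else false
  refine ⟨fun i => Nat.ofBits fun r : Fin h => f i r, fun i => Nat.ofBits_lt_two_pow _, ?_⟩
  rw [φ.everyClauseTrue_iff]
  intro C hC
  obtain ⟨l, hl, ht⟩ := hb C hC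
  refine ⟨l, hl, (l.1 : ℕ) / h, ?_, (literalTrue_literalCode l).2 ⟨rfl, ?_⟩⟩
  · rw [Nat.div_lt_iff_lt_mul hh]
    exact l.1.isLt.trans_le hN
  · have hr : (l.1 : ℕ) % h < h := Nat.mod_lt _ hh
    have h1 := Nat.testBit_ofBits_lt (fun r : Fin h => f ((l.1 : ℕ) / h) r) _ hr
    have h2 : f ((l.1 : ℕ) / h) ((l.1 : ℕ) % h) = l.2 := by
      simp only [f, Nat.div_add_mod']
      rw [dif_pos l.1.isLt, ← ht]
    rw [← Nat.toNat_testBit, h1]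
    simp only [h2]

/-! ### The word of a formula, and its computation -/

section Reduction

/-- The number of variables per thread when `N` variables are distributed to `α` threads. It is
always positive and at least `N / α`, at the cost of one superfluous variable if `α` divides `N`. -/
def groupSize (α N : ℕ) : ℕ := N / α + 1

/-- The number of letters per thread for a formula with `N` variables and encoding length `ℓ`:
`ℓ` letters for each number below `2 ^ (groupSize α N + 1)`. Every assignment to the variables of
the thread is given by a number below `2 ^ groupSize α N`, and its block is not the last one. -/
def threadLength (α ℓ N : ℕ) : ℕ := ℓ * 2 ^ (groupSize α N + 1)

instance (h i a c : ℕ) : Decidable (LiteralTrue h i a c) := by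
  unfold LiteralTrue
  infer_instance

/-- The symbol number `r` in thread `i` for the cells `e`, with block length `ℓ`. -/
def blockSymbol (e : ℕ → ℕ) (h ℓ i r : ℕ) : ℕ :=
  if r % ℓ = 0 then 3 else if e (r % ℓ) = 0 then 2 else
    if LiteralTrue h i (r / ℓ) (e (r % ℓ)) then 1 else 0

theorem blockSymbol_lt (e : ℕ → ℕ) (h ℓ i r : ℕ) : blockSymbol e h ℓ i r < 4 := by
  unfold blockSymbol
  split_ifs <;> norm_num

/-- The letter number `q` of the word for the cells `e`, the encoding length `ℓ` and the number of
variables `N`. -/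
def letterValue (e : ℕ → ℕ) (α ℓ N q : ℕ) : ℕ :=
  4 * (q / threadLength α ℓ N) +
    blockSymbol e (groupSize α N) ℓ (q / threadLength α ℓ N) (q % threadLength α ℓ N)

open WordRAM (Expr)

/-- Computes `groupSize`; memory cell `0` holds the number of variables. -/
def groupExpr (α : ℕ) : Expr := .op .add (.op .div (.load (.lit 0)) (.lit α)) (.lit 1)

/-- Computes `threadLength`; register `K` holds the encoding length. -/
def threadExpr (K α : ℕ) : Expr := .op .mul (.reg K) (.op .shl (.lit 2) (groupExpr α))

/-- Computes the length of the word. -/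
def sizeExpr (K α : ℕ) : Expr := .op .mul (.lit α) (threadExpr K α)

/-- Computes the thread of the letter whose number is in register `K + 1`. -/
def indexExpr (K α : ℕ) : Expr := .op .div (.reg (K + 1)) (threadExpr K α)

/-- Computes the number within its thread of the letter whose number is in register `K + 1`. -/
def offsetExpr (K α : ℕ) : Expr := .op .mod (.reg (K + 1)) (threadExpr K α)

/-- Computes the position of the letter within its block. -/
def positionExpr (K α : ℕ) : Expr := .op .mod (offsetExpr K α) (.reg K)

/-- Computes the cell of the encoding that the letter belongs to, minus one: for the code
`2 * v + b + 1` of a literal, this is `2 * v + b`. -/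
def codeExpr (K α : ℕ) : Expr := .op .sub (.load (positionExpr K α)) (.lit 1)

/-- The absolute difference of two expressions, by truncated subtraction. -/
def distExpr (a b : Expr) : Expr := .op .add (.op .sub a b) (.op .sub b a)

/-- Computes a number that is zero if and only if the literal belongs to the thread and is true. -/
def mismatchExpr (K α : ℕ) : Expr :=
  .op .add
    (distExpr (.op .div (.op .div (codeExpr K α) (.lit 2)) (groupExpr α)) (indexExpr K α))
    (distExpr
      (.op .mod
        (.op .shr (.op .div (offsetExpr K α) (.reg K))
          (.op .mod (.op .div (codeExpr K α) (.lit 2)) (groupExpr α)))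
        (.lit 2))
      (.op .mod (codeExpr K α) (.lit 2)))

/-- `1` if the expression is zero, and `0` otherwise. -/
def isZeroExpr (a : Expr) : Expr := .op .sub (.lit 1) a

/-- Computes `letterValue`. The three cases of `blockSymbol` other than the last are added up, where
truncated subtraction makes all but one of them zero. -/
def letterExpr (K α : ℕ) : Expr :=
  .op .add (.op .mul (.lit 4) (indexExpr K α))
    (.op .add (.op .mul (.lit 3) (isZeroExpr (positionExpr K α)))
      (.op .add
        (.op .mul (.lit 2) (.op .sub (isZeroExpr (.load (positionExpr K α)))
          (isZeroExpr (positionExpr K α))))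
        (isZeroExpr (.op .add (mismatchExpr K α)
          (.op .add (isZeroExpr (.load (positionExpr K α)))
            (isZeroExpr (positionExpr K α)))))))

theorem regsBelow_sizeExpr (K α : ℕ) : (sizeExpr K α).RegsBelow (K + 2) := by
  simp [sizeExpr, threadExpr, groupExpr, Expr.RegsBelow]

theorem regsBelow_letterExpr (K α : ℕ) : (letterExpr K α).RegsBelow (K + 2) := by
  simp [letterExpr, mismatchExpr, distExpr, isZeroExpr, codeExpr, positionExpr, offsetExpr,
    indexExpr, threadExpr, groupExpr, Expr.RegsBelow]

variable {K α ℓ N q B : ℕ} {R M : ℕ → ℕ}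

theorem eval_groupExpr (hN : M 0 = N) : (groupExpr α).eval R M = groupSize α N := by
  simp [groupExpr, Expr.eval, WordRAM.Op.eval, hN, groupSize]

theorem eval_threadExpr (hℓ : R K = ℓ) (hN : M 0 = N) :
    (threadExpr K α).eval R M = threadLength α ℓ N := by
  simp only [threadExpr, Expr.eval, WordRAM.Op.eval, hℓ, eval_groupExpr hN, threadLength,
    Nat.shiftLeft_eq, pow_succ']

theorem groupSize_le_two_pow : groupSize α N ≤ 2 ^ (groupSize α N + 1) :=
  (Nat.le_succ _).trans Nat.lt_two_pow_self.le

theorem two_pow_le_threadLength (hℓ : 0 < ℓ) : 2 ^ (groupSize α N + 1) ≤ threadLength α ℓ N :=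
  Nat.le_mul_of_pos_left _ hℓ

theorem threadExpr_bounded (hℓ0 : 0 < ℓ) (hℓ : R K = ℓ) (hN : M 0 = N)
    (hα' : α ≤ B) (h1 : 2 ≤ B)
    (hB : threadLength α ℓ N ≤ B) :
    (threadExpr K α).Bounded R M B ∧ (groupExpr α).Bounded R M B := by
  have h2 := groupSize_le_two_pow (α := α) (N := N)
  have h3 := two_pow_le_threadLength (α := α) (N := N) hℓ0
  have h4 := eval_groupExpr (R := R) (α := α) hN
  have h5 := eval_threadExpr (α := α) hℓ hN
  have h6 : N / α ≤ groupSize α N := Nat.le_succ _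
  have hg : (groupExpr α).Bounded R M B := by
    simp only [groupExpr, Expr.Bounded, Expr.eval, WordRAM.Op.eval, hN] at h4 ⊢
    refine ⟨⟨Nat.zero_le _, hα', by omega⟩, by omega, by omega⟩
  refine ⟨⟨trivial, ⟨h1, hg, ?_⟩, h5.trans_le hB⟩, hg⟩
  simp only [Expr.eval, WordRAM.Op.eval, h4, Nat.shiftLeft_eq, ← pow_succ']
  omega

theorem sizeExpr_spec (hℓ0 : 0 < ℓ) (hα : 0 < α) (hℓ : R K = ℓ) (hN : M 0 = N) (hα' : α ≤ B)
    (h1 : 2 ≤ B) (hB : α * threadLength α ℓ N ≤ B) :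
    (sizeExpr K α).eval R M = α * threadLength α ℓ N ∧ (sizeExpr K α).Bounded R M B := by
  have h5 := eval_threadExpr (α := α) hℓ hN
  have he : (sizeExpr K α).eval R M = α * threadLength α ℓ N := by
    simp only [sizeExpr, Expr.eval, WordRAM.Op.eval, h5]
  exact ⟨he, hα', (threadExpr_bounded hℓ0 hℓ hN hα' h1
    ((Nat.le_mul_of_pos_left _ hα).trans hB)).1, he.trans_le hB⟩

theorem letterExpr_spec (hℓ0 : 0 < ℓ) (hα : 0 < α) (hℓ : R K = ℓ) (hq : R (K + 1) = q)
    (hqn : q < α * threadLength α ℓ N) (hN : M 0 = N) (hα' : 4 * α ≤ B) (h1 : 8 ≤ B)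
    (hB : α * threadLength α ℓ N ≤ B) (hM : ∀ j < ℓ, M j ≤ B) :
    (letterExpr K α).eval R M = letterValue M α ℓ N q ∧ (letterExpr K α).Bounded R M B := by
  have hmB : threadLength α ℓ N ≤ B := (Nat.le_mul_of_pos_left _ hα).trans hB
  obtain ⟨bt, bg⟩ := threadExpr_bounded hℓ0 hℓ hN (B := B) (by omega) (by omega) hmB
  have et := eval_threadExpr (α := α) hℓ hN
  have eg := eval_groupExpr (R := R) (α := α) hN
  have hi : q / threadLength α ℓ N < α := by
    rw [Nat.div_lt_iff_lt_mul ((two_pow_le_threadLength hℓ0).trans_lt' (by positivity))]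
    exact hqn
  set i := q / threadLength α ℓ N with hidef
  set r := q % threadLength α ℓ N with hrdef
  set h := groupSize α N with hh
  have ei : (indexExpr K α).eval R M = i := by
    simp only [indexExpr, Expr.eval, WordRAM.Op.eval, et, hq, hidef]
  have er : (offsetExpr K α).eval R M = r := by
    simp only [offsetExpr, Expr.eval, WordRAM.Op.eval, et, hq, hrdef]
  have hrB : r ≤ B := (Nat.mod_le _ _).trans (hqn.le.trans hB)
  have ep : (positionExpr K α).eval R M = r % ℓ := by
    simp only [positionExpr, Expr.eval, WordRAM.Op.eval, er, hℓ]
  have hp : r % ℓ ≤ B := (Nat.mod_le _ _).trans hrB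
  have hc : M (r % ℓ) ≤ B := hM _ (Nat.mod_lt _ hℓ0)
  have ec : (codeExpr K α).eval R M = M (r % ℓ) - 1 := by
    simp only [codeExpr, Expr.eval, WordRAM.Op.eval, ep]
  have bi : (indexExpr K α).Bounded R M B :=
    ⟨trivial, bt, by rw [et]; simp only [Expr.eval, hq, WordRAM.Op.eval, ← hidef]; omega⟩
  have br : (offsetExpr K α).Bounded R M B :=
    ⟨trivial, bt, by rw [et]; simpa only [Expr.eval, hq, WordRAM.Op.eval, ← hrdef]⟩
  have bp : (positionExpr K α).Bounded R M B :=
    ⟨br, trivial, by rw [er]; simpa only [Expr.eval, hℓ, WordRAM.Op.eval]⟩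
  have bc : (codeExpr K α).Bounded R M B :=
    ⟨bp, by simp only [Expr.Bounded]; omega, by simp only [Expr.eval, ep, WordRAM.Op.eval]; omega⟩
  -- the values of the remaining subexpressions of `letterExpr`
  have g1 : (M (r % ℓ) - 1) / 2 / h ≤ (M (r % ℓ) - 1) / 2 := Nat.div_le_self _ _
  have g2 : (M (r % ℓ) - 1) / 2 % h ≤ (M (r % ℓ) - 1) / 2 := Nat.mod_le _ _
  have g3 : r / ℓ ≤ r := Nat.div_le_self _ _
  have g4 : (r / ℓ) >>> ((M (r % ℓ) - 1) / 2 % h) ≤ r / ℓ := Nat.shiftRight_le _ _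
  have g5 : (r / ℓ) >>> ((M (r % ℓ) - 1) / 2 % h) % 2 < 2 := Nat.mod_lt _ (by norm_num)
  constructor
  · have key : (mismatchExpr K α).eval R M = 0 ↔ LiteralTrue h i (r / ℓ) (M (r % ℓ)) := by
      simp only [mismatchExpr, distExpr, Expr.eval, WordRAM.Op.eval, ei, er, ec, eg, hℓ,
        LiteralTrue, Nat.shiftRight_eq_div_pow]
      omega
    simp only [letterExpr, isZeroExpr, Expr.eval, WordRAM.Op.eval, ei, ep, letterValue,
      ← hidef, ← hrdef, ← hh, blockSymbol, ← key]
    split_ifs <;> omega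
  · simp only [letterExpr, mismatchExpr, distExpr, isZeroExpr, Expr.Bounded, Expr.eval,
      WordRAM.Op.eval, ei, er, ec, eg, ep, hℓ, bi, br, bp, bc, bg, true_and]
    generalize (M (r % ℓ) - 1) / 2 / h = x₁ at *
    generalize (M (r % ℓ) - 1) / 2 % h = x₂ at *
    generalize (r / ℓ) >>> x₂ = x₃ at *
    generalize r / ℓ = x₄ at *
    omega

end Reduction

section Reduction

/-- The letter with number `r` in thread `i` of the word of a formula. -/
def formulaLetter {α k : ℕ} (hα : 0 < α) (φ : KCNF k) (i r : ℕ) : Fin (4 * α) :=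
  ⟨(4 * i + blockSymbol φ.cell (groupSize α φ.numVars) φ.encode.length i r) % (4 * α),
    Nat.mod_lt _ (by omega)⟩

/-- The instance of predictive trace monitoring that expresses the satisfiability of a formula. -/
def formulaWord {α k : ℕ} (hα : 0 < α) (φ : KCNF k) : List (Fin (4 * α)) :=
  (List.range (α * threadLength α φ.encode.length φ.numVars)).map fun q =>
    formulaLetter hα φ (q / threadLength α φ.encode.length φ.numVars)
      (q % threadLength α φ.encode.length φ.numVars)

variable {α k : ℕ}

theorem length_encode_pos (φ : KCNF k) : 0 < φ.encode.length := by simp [KCNF.encode]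

theorem val_formulaLetter (hα : 0 < α) (φ : KCNF k) {i : ℕ} (hi : i < α) (r : ℕ) :
    (formulaLetter hα φ i r : ℕ) =
      4 * i + blockSymbol φ.cell (groupSize α φ.numVars) φ.encode.length i r := by
  have := blockSymbol_lt φ.cell (groupSize α φ.numVars) φ.encode.length i r
  exact Nat.mod_eq_of_lt (by omega)

theorem map_val_formulaWord (hα : 0 < α) (φ : KCNF k) : (formulaWord hα φ).map Fin.val =
    (List.range (α * threadLength α φ.encode.length φ.numVars)).map
      (letterValue φ.cell α φ.encode.length φ.numVars) := by
  rw [formulaWord, List.map_map]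
  refine List.map_congr_left fun q hq => ?_
  rw [List.mem_range] at hq
  rw [Function.comp_apply, val_formulaLetter hα φ, letterValue]
  exact Nat.div_lt_of_lt_mul (by rwa [Nat.mul_comm])

theorem map_range_mul {β : Type*} (f : ℕ → ℕ → β) {m : ℕ} (hm : 0 < m) (n : ℕ) :
    (List.range (n * m)).map (fun q => f (q / m) (q % m)) =
      (List.range n).flatMap fun i => (List.range m).map (f i) := by
  induction n with
  | zero => simp
  | succ n ih =>
    rw [Nat.succ_mul, List.range_add, List.map_append, ih, List.range_succ, List.flatMap_append,
      List.flatMap_singleton, List.map_map]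
    congr 1
    refine List.map_congr_left fun q hq => ?_
    rw [List.mem_range] at hq
    rw [Function.comp_apply, Nat.mul_add_mod_self_right, Nat.mod_eq_of_lt hq, Nat.mul_comm,
      Nat.mul_add_div hm, Nat.div_eq_of_lt hq, Nat.add_zero]

theorem isBlockWord_formulaWord (hα : 0 < α) (φ : KCNF k) :
    IsBlockWord φ.encode.length (2 ^ (groupSize α φ.numVars + 1)) φ.cell
      (fun i a j => LiteralTrue (groupSize α φ.numVars) i a (φ.cell j))
      (formulaLetter hα φ) (formulaWord hα φ) := by
  have hth : ∀ i < α, ∀ r, thread (formulaLetter hα φ i r) = i := by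
    intro i hi r
    have := blockSymbol_lt φ.cell (groupSize α φ.numVars) φ.encode.length i r
    rw [thread, val_formulaLetter hα φ hi]
    omega
  have hsym : ∀ i < α, ∀ r, symbol (formulaLetter hα φ i r) =
      blockSymbol φ.cell (groupSize α φ.numVars) φ.encode.length i r := by
    intro i hi r
    have := blockSymbol_lt φ.cell (groupSize α φ.numVars) φ.encode.length i r
    rw [symbol, val_formulaLetter hα φ hi]
    omega
  refine ⟨fun i hi r _ => hth i hi r, fun i hi r _ => ?_, fun i hi r _ => ?_, fun i hi r _ => ?_,
    fun i hi => ?_⟩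
  · rw [hsym i hi, blockSymbol]
    split_ifs <;> simp_all
  · rw [hsym i hi, blockSymbol]
    split_ifs <;> simp_all
  · rw [hsym i hi, blockSymbol]
    split_ifs <;> simp_all
  · rw [formulaWord, map_range_mul _ ((two_pow_le_threadLength (length_encode_pos φ)).trans_lt'
      (by positivity)), filter_thread_flatMap, if_pos hi]
    · rfl
    · intro j hj x hx
      obtain ⟨r, -, rfl⟩ := List.mem_map.1 hx
      exact hth j hj r

theorem numVars_le (hα : 0 < α) (φ : KCNF k) : φ.numVars ≤ α * groupSize α φ.numVars :=
  (Nat.lt_mul_div_succ _ hα).le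

theorem formulaWord_mem_iff (hα : 0 < α) (φ : KCNF k) :
    formulaWord hα φ ∈ PredictiveMonitoring (threadGraph α) (checkLanguage α) ↔
      φ.Satisfiable := by
  have hw := isBlockWord_formulaWord hα φ
  constructor
  · intro h
    obtain ⟨a, ha⟩ := hw.exists_of_mem hα (length_encode_pos φ) h
    exact KCNF.satisfiable_of_everyClauseTrue ha
  · intro h
    obtain ⟨a, ha, hc⟩ := h.exists_everyClauseTrue (α := α) (h := groupSize α φ.numVars)
      (Nat.succ_pos _) (numVars_le hα φ)
    refine hw.mem_predictiveMonitoring hα (length_encode_pos φ) (a := a) (fun i _ => ?_) hc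
    have := ha i
    rw [pow_succ]
    omega

theorem le_of_mem_encode {φ : KCNF k} {v : ℕ} (hv : v ∈ φ.encode) : v ≤ 2 * φ.numVars := by
  simp only [KCNF.encode, List.mem_cons, List.mem_flatMap, List.mem_append, List.mem_map,
    List.not_mem_nil, or_false] at hv
  rcases hv with rfl | ⟨C, -, ⟨l, -, rfl⟩ | rfl⟩
  · omega
  · have := l.1.isLt
    have := Bool.toNat_lt l.2
    omega
  · omega

/-- The length of the word of a formula. -/
def wordLength (α : ℕ) {k : ℕ} (φ : KCNF k) : ℕ := α * threadLength α φ.encode.length φ.numVars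

theorem letterValue_congr {e e' : ℕ → ℕ} {ℓ N q : ℕ} (hℓ : 0 < ℓ) (h : ∀ j < ℓ, e j = e' j) :
    letterValue e α ℓ N q = letterValue e' α ℓ N q := by
  rw [letterValue, letterValue, blockSymbol, blockSymbol, h _ (Nat.mod_lt _ hℓ)]

/-- An algorithm for predictive trace monitoring yields an algorithm for satisfiability. -/
theorem exists_decides_satisfiable (hα : 0 < α) {m : WordRAM.Mode} {p : WordRAM.Program}
    {T : ℕ → ℕ} (hadm : m.Admits p)
    (hdec : WordRAM.Decides p (fun w : List (Fin (4 * α)) => w.map Fin.val)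
      (PredictiveMonitoring (threadGraph α) (checkLanguage α)) fun w => T w.length) (k : ℕ) :
    ∃ (P : WordRAM.Program) (τ : KCNF k → ℕ) (C : ℕ), m.Admits P ∧
      WordRAM.Decides P KCNF.encode {φ : KCNF k | φ.Satisfiable} τ ∧
      ∀ φ, τ φ ≤ C * (wordLength α φ + T (wordLength α φ)) := by
  obtain ⟨K, hK, hp⟩ := WordRAM.exists_regsBelow p
  obtain ⟨c, hc⟩ := hdec
  let b := (WordRAM.tabulateBody K (sizeExpr K α) (letterExpr K α)).length
  let f := (WordRAM.tabulateEnd K (sizeExpr K α)).length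
  let τ : KCNF k → ℕ := fun φ => WordRAM.tabulateTime K (sizeExpr K α) (letterExpr K α)
    (wordLength α φ) (T (wordLength α φ))
  have hτ : ∀ φ, τ φ = 1 + wordLength α φ * (b + 1) + f + 2 * T (wordLength α φ) :=
    fun φ => rfl
  have hαn : ∀ φ : KCNF k, α * groupSize α φ.numVars ≤ wordLength α φ := fun φ =>
    Nat.mul_le_mul_left _ (groupSize_le_two_pow.trans
      (two_pow_le_threadLength (length_encode_pos φ)))
  have hn : ∀ φ : KCNF k, α ≤ wordLength α φ := fun φ =>
    (Nat.le_mul_of_pos_right _ (Nat.succ_pos _)).trans (hαn φ)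
  refine ⟨WordRAM.tabulateThen K (sizeExpr K α) (letterExpr K α) p, τ, b + f + 4, ?_,
    ⟨c + 3, fun φ => ?_⟩, fun φ => ?_⟩
  · cases m with
    | deterministic => exact WordRAM.flip_notMem_tabulateThen hadm
    | randomized => trivial
  · set X := φ.encode.length + τ φ + 2 with hX
    have hnτ : wordLength α φ ≤ τ φ := by
      rw [hτ]
      have := Nat.le_mul_of_pos_right (wordLength α φ) (Nat.succ_pos b)
      simp only [Nat.succ_eq_add_one] at this
      omega
    have hTτ : T (wordLength α φ) + wordLength α φ ≤ τ φ := by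
      rw [hτ]
      have := Nat.le_mul_of_pos_right (wordLength α φ) (Nat.succ_pos b)
      simp only [Nat.succ_eq_add_one] at this
      omega
    have hX2 : 2 ≤ X := by omega
    have hXc : 1 ≤ X ^ c := Nat.one_le_pow _ _ (by omega)
    have h4X : 4 * X ≤ X ^ (c + 3) :=
      calc 4 * X ≤ 1 * (X * X * X) := by nlinarith
        _ ≤ X ^ c * (X * X * X) := Nat.mul_le_mul_right _ hXc
        _ = X ^ (c + 3) := by ring
    have hBX : X ^ c + X ≤ X ^ (c + 3) :=
      calc X ^ c + X ≤ X ^ c * X + X ^ c * X := add_le_add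
            (Nat.le_mul_of_pos_right _ (by omega)) (Nat.le_mul_of_pos_left _ (by omega))
        _ = X ^ c * X * 2 := by ring
        _ ≤ X ^ c * X * X := Nat.mul_le_mul_left _ hX2
        _ ≤ X ^ c * X * X * X := Nat.le_mul_of_pos_right _ (by omega)
        _ = X ^ (c + 3) := by ring
    -- the numbers in the input may exceed its length, but not the length of the word
    have hcells : ∀ v ∈ φ.encode, v ≤ X ^ (c + 3) := fun v hv => by
      have h1 := le_of_mem_encode hv
      have h2 := numVars_le hα φ
      have h3 := hαn φ
      omega
    have hlen : (formulaWord hα φ).length = wordLength α φ := by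
      simp [formulaWord, wordLength]
    have hcell0 : φ.encode.getD 0 0 = φ.numVars := rfl
    obtain ⟨hrun, hprob⟩ := hc (formulaWord hα φ)
    simp only [hlen, map_val_formulaWord, List.length_map, List.length_range] at hrun hprob
    have main := fun ω => WordRAM.tabulateThen_correct (ω := ω) (x := φ.encode)
      (n := wordLength α φ) (B := X ^ (c + 3)) (B' := X ^ c)
      (g := letterValue φ.cell α φ.encode.length φ.numVars) hK hp (regsBelow_sizeExpr K α)
      (regsBelow_letterExpr K α) (hα.trans_le (hn φ)) (by omega) hcells (by omega)
      (fun R M hR hM => sizeExpr_spec (length_encode_pos φ) hα hR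
        (by rw [hM 0 (length_encode_pos φ), hcell0]) (by have := hn φ; omega) (by omega)
        (show wordLength α φ ≤ _ by omega))
      (fun R M q hq hR hR' hM => by
        have := letterExpr_spec (R := R) (M := M) (B := X ^ (c + 3)) (N := φ.numVars)
          (length_encode_pos φ) hα hR hR' hq (by rw [hM 0 (length_encode_pos φ), hcell0])
          (by have := hn φ; omega) (by omega)
          (show wordLength α φ ≤ _ by omega)
          (fun j hj => by
            rw [hM j hj, List.getD_eq_getElem _ _ hj]
            exact hcells _ (List.getElem_mem hj))
        exact ⟨this.1.trans (letterValue_congr (length_encode_pos φ) hM), this.2⟩)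
      (T (wordLength α φ)) (fun s hs => by
        have h1 := (hrun ω).2 s hs
        have h2 : (wordLength α φ + T (wordLength α φ) + 2) ^ c ≤ X ^ c :=
          Nat.pow_le_pow_left (by omega) c
        exact ⟨fun i => (h1.1 i).trans h2, fun i => (h1.2 i).trans h2⟩)
    refine ⟨fun ω => ⟨(main ω).1.2 (hrun ω).1, (main ω).2.2⟩, ?_⟩
    refine hprob.trans_eq (congrArg _ (Set.ext fun ω => ?_))
    exact iff_congr (main ω).2.1.symm (formulaWord_mem_iff hα φ)
  · rw [hτ]
    have := (hn φ).trans' hα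
    nlinarith [Nat.zero_le (T (wordLength α φ)), Nat.zero_le b, Nat.zero_le f,
      Nat.mul_le_mul_left f this, Nat.zero_le (b * T (wordLength α φ)),
      Nat.zero_le (f * T (wordLength α φ))]

end Reduction

/-! ### The time bound -/

theorem cliqueNum_bot_two : (⊥ : SimpleGraph (Fin 2)).cliqueNum = 1 := by
  apply le_antisymm
  · obtain ⟨s, hs⟩ := (⊥ : SimpleGraph (Fin 2)).exists_isNClique_cliqueNum
    rw [← hs.card_eq, Finset.card_le_one]
    intro x hx y hy
    by_contra hne
    simpa using hs.isClique hx hy hne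
  · have : (⊥ : SimpleGraph (Fin 2)).IsClique ({0} : Finset (Fin 2)) := by simp
    simpa using this.card_le_cliqueNum

theorem isStarFree_containsOne : IsStarFree containsOne :=
  .concat (.concat .top (.letter 1)) .top

theorem exists_forall_le_rpow {T : ℕ → ℕ} {e : ℝ} (he : 0 ≤ e)
    (hT : (fun n : ℕ => (T n : ℝ)) =O[atTop] fun n : ℕ => (n : ℝ) ^ e) :
    ∃ D : ℝ, 0 ≤ D ∧ ∀ n, 0 < n → (T n : ℝ) ≤ D * (n : ℝ) ^ e := by
  obtain ⟨c, hc, hT⟩ := hT.exists_nonneg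
  obtain ⟨n₀, hn₀⟩ := eventually_atTop.1 hT.bound
  have hsum : (0 : ℝ) ≤ ∑ n ∈ Finset.range n₀, (T n : ℝ) :=
    Finset.sum_nonneg fun _ _ => Nat.cast_nonneg _
  refine ⟨c + ∑ n ∈ Finset.range n₀, (T n : ℝ), by positivity, fun n hn => ?_⟩
  have hn1 : (1 : ℝ) ≤ (n : ℝ) ^ e := Real.one_le_rpow (by exact_mod_cast hn) he
  rcases le_or_gt n₀ n with h | h
  · have := hn₀ n h
    rw [Real.norm_of_nonneg (Nat.cast_nonneg _), Real.norm_of_nonneg (by positivity)] at this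
    nlinarith
  · have := Finset.single_le_sum (f := fun n => (T n : ℝ)) (fun _ _ => Nat.cast_nonneg _)
      (Finset.mem_range.2 h)
    nlinarith

/-- The word has length `O(ℓ * 2 ^ (N / α))`; the factor `4` comes from the rounding of `N / α` and
from the doubled number of blocks. -/
theorem wordLength_le {α k : ℕ} (hα : 0 < α) (φ : KCNF k) :
    (wordLength α φ : ℝ) ≤ 4 * α * φ.encode.length * (2 : ℝ) ^ ((φ.numVars : ℝ) / α) := by
  have h1 : ((2 ^ (φ.numVars / α) : ℕ) : ℝ) ≤ (2 : ℝ) ^ ((φ.numVars : ℝ) / α) := by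
    rw [Nat.cast_pow, Nat.cast_ofNat, ← Real.rpow_natCast]
    exact Real.rpow_le_rpow_of_exponent_le one_le_two Nat.cast_div_le
  have h2 : wordLength α φ = 4 * α * φ.encode.length * 2 ^ (φ.numVars / α) := by
    simp only [wordLength, threadLength, groupSize]
    ring
  rw [h2]
  push_cast at h1 ⊢
  gcongr

/-- Solving predictive trace monitoring over `α` threads in time `O(n ^ (α - ε))` contradicts the
strong exponential time hypothesis. -/
theorem not_monitoringSolvable_checkLanguage {m : WordRAM.Mode} (hSETH : SETH m) {ε : ℝ}
    (hε : 0 < ε) (hε1 : ε ≤ 1) {α : ℕ} (hα : 2 ≤ α) :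
    ¬ MonitoringSolvable m (threadGraph α) (checkLanguage α) ((α : ℝ) - ε) := by
  rintro ⟨p, T, hadm, hdec, hT⟩
  simp only [monitoringEncoding_eq] at hdec
  have hα0 : 0 < α := by omega
  have hαR : (2 : ℝ) ≤ α := by exact_mod_cast hα
  obtain ⟨D, hD, hTD⟩ := exists_forall_le_rpow (by linarith) hT
  obtain ⟨k, hk⟩ := hSETH (ε / α) (by positivity)
  obtain ⟨P, τ, C, hP, hPdec, hτ⟩ := exists_decides_satisfiable hα0 hadm hdec k
  set E : ℝ := C * (1 + D) * (4 * α) ^ α with hE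
  obtain ⟨c₀, hc₀⟩ := exists_nat_ge E
  refine hk ⟨P, τ, max c₀ α, hP, hPdec, fun φ => ?_⟩
  have hℓ : (1 : ℝ) ≤ φ.encode.length := by exact_mod_cast length_encode_pos φ
  set n := wordLength α φ with hn
  have hn0 : 0 < n := Nat.mul_pos hα0 ((two_pow_le_threadLength (length_encode_pos φ)).trans_lt'
    (by positivity))
  have hn1 : (1 : ℝ) ≤ n := by exact_mod_cast hn0
  have h1 : (τ φ : ℝ) ≤ C * (n + T n) := by exact_mod_cast hτ φ
  have h2 : (n : ℝ) ≤ (n : ℝ) ^ ((α : ℝ) - ε) := by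
    conv_lhs => rw [← Real.rpow_one (n : ℝ)]
    exact Real.rpow_le_rpow_of_exponent_le hn1 (by linarith)
  have hbase : (1 : ℝ) ≤ 4 * α * φ.encode.length := by nlinarith
  have h3 : (n : ℝ) ^ ((α : ℝ) - ε) ≤
      (4 * α * φ.encode.length : ℝ) ^ α * (2 : ℝ) ^ ((1 - ε / α) * (φ.numVars : ℝ)) :=
    calc (n : ℝ) ^ ((α : ℝ) - ε)
        ≤ (4 * α * φ.encode.length * (2 : ℝ) ^ ((φ.numVars : ℝ) / α)) ^ ((α : ℝ) - ε) :=
          Real.rpow_le_rpow (by positivity) (wordLength_le hα0 φ) (by linarith)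
      _ = (4 * α * φ.encode.length : ℝ) ^ ((α : ℝ) - ε) *
          (2 : ℝ) ^ ((1 - ε / α) * (φ.numVars : ℝ)) := by
          rw [Real.mul_rpow (by positivity) (by positivity), ← Real.rpow_mul (by norm_num)]
          congr 2
          field_simp
      _ ≤ _ := by
          gcongr
          rw [← Real.rpow_natCast]
          exact Real.rpow_le_rpow_of_exponent_le hbase (by linarith)
  have hℓα : (φ.encode.length : ℝ) ^ α ≤ (φ.encode.length : ℝ) ^ max c₀ α :=
    pow_le_pow_right₀ hℓ (le_max_right _ _)
  have hEc : E ≤ ((max c₀ α : ℕ) : ℝ) := hc₀.trans (by exact_mod_cast le_max_left _ _)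
  calc (τ φ : ℝ) ≤ C * ((n : ℝ) ^ ((α : ℝ) - ε) + D * (n : ℝ) ^ ((α : ℝ) - ε)) := by
        refine h1.trans ?_
        gcongr
        exact hTD n hn0
    _ = C * (1 + D) * (n : ℝ) ^ ((α : ℝ) - ε) := by ring
    _ ≤ C * (1 + D) * ((4 * α * φ.encode.length : ℝ) ^ α *
          (2 : ℝ) ^ ((1 - ε / α) * (φ.numVars : ℝ))) := by gcongr
    _ = E * (φ.encode.length : ℝ) ^ α * (2 : ℝ) ^ ((1 - ε / α) * (φ.numVars : ℝ)) := by
        rw [hE, mul_pow]; ring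
    _ ≤ _ := by gcongr

theorem MonitoringSolvable.mono {m : WordRAM.Mode} {s : ℕ} {I : SimpleGraph (Fin s)}
    {L : Language (Fin s)} {e e' : ℝ} (h : MonitoringSolvable m I L e) (he : e ≤ e') :
    MonitoringSolvable m I L e' := by
  obtain ⟨p, T, hadm, hdec, hT⟩ := h
  refine ⟨p, T, hadm, hdec, hT.trans (Asymptotics.IsBigO.of_bound 1 ?_)⟩
  filter_upwards [eventually_ge_atTop 1] with n hn
  rw [Real.norm_of_nonneg (by positivity), Real.norm_of_nonneg (by positivity), one_mul]
  exact Real.rpow_le_rpow_of_exponent_le (by exact_mod_cast hn) he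

theorem mainTheorem1 (m : WordRAM.Mode) (hSETH : SETH m) (ε : ℝ) (hε : 0 < ε)
    (α : ℕ) (hα : 1 ≤ α) :
    ¬ ∀ (s : ℕ) (I : SimpleGraph (Fin s)) (L : Language (Fin s)),
        I.cliqueNum = α → IsStarFree L → MonitoringSolvable m I L ((α : ℝ) - ε) := by
  intro H
  rcases hα.eq_or_lt with rfl | hα2
  · have := H 2 ⊥ containsOne cliqueNum_bot_two isStarFree_containsOne
    exact not_monitoringSolvable_containsOne hε (by simpa using this)
  · have := H (4 * α) (threadGraph α) (checkLanguage α) (cliqueNum_threadGraph α)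
      (isStarFree_checkLanguage α)
    exact not_monitoringSolvable_checkLanguage hSETH (lt_min hε one_pos) (min_le_right ε 1) hα2
      (this.mono (by linarith [min_le_left ε 1]))
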